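/- **Theorem 2.2.** For points $A,B\in\mathbb Z^2$, let $\mathcal P_{A\to B}$ be the set of lattice paths from $A$ to $B$ with steps $N=(0,1)$ and $E=(1,0)$. Number the vertices of a path along the path, starting at $0$. A *descent* of a path is a vertex preceded by an $E$ and followed by an $N$; $\mathrm{des}(P)$ is the number of descents of $P$, and $\mathrm{maj}(P)$ is the sum of the positions of the descents of $P$. If $V_1,\dots,V_s$ ($s\ge1$) is a maximal sequence of consecutive common vertices of two paths $P$ and $Q$ such that neither $V_1$ nor $V_s$ is an endpoint of $P$ or $Q$ and such that, for each of $P$ and $Q$, the step arriving at $V_1$ is of the same type ($N$ or $E$) as the step leaving $V_s$, then $V_s$ is called a *crossing* of $P$ and $Q$. Let $\mathrm{cro}(P,Q)$ be the number of crossings, and for points $A_1,A_2,C_1,C_2\in\mathbb Z^2$ and $r\ge0$ let $$H^{\ge r}_{A_1\to C_1,A_2\to C_2}(t,q)=\sum_{\substack{P\in\mathcal P_{A_1\to C_1},\ Q\in\mathcal P_{A_2\to C_2}\\ \mathrm{cro}(P,Q)\ge r}}t^{\mathrm{des}(P)+\mathrm{des}(Q)}q^{\mathrm{maj}(P)+\mathrm{maj}(Q)}.$$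 For $m,n\in\mathbb Z$ let $\binom{m}{n}_q=\frac{(1-q^m)(1-q^{m-1})\cdots(1-q^{m-n+1})}{(1-q^n)(1-q^{n-1})\cdots(1-q)}$ if $0\le n\le m$, and $\binom{m}{n}_q=0$ otherwise. For $k\in\mathbb Z$ and $A_1=(x_1,y_1)$, $A_2=(x_2,y_2)$, $B_1=(u_1,v_1)$, $B_2=(u_2,v_2)$ let $$f_{k,A_1,A_2,B_2,B_1}(t,q)=q^{k(k+x_2-x_1)}\left(\sum_{n\ge0}t^nq^{n(n+k)}\binom{u_2-x_1}{n}_q\binom{v_2-y_1}{n+k}_q\right)\left(\sum_{n\ge0}t^nq^{n(n-k)}\binom{u_1-x_2}{n}_q\binom{v_1-y_2}{n-k}_q\right).$$ Write $(x,y)\prec(x',y')$ if $x<x'$ and $y>y'$. Let $A_1=(x_1,y_1)$, $A_2=(x_2,y_2)$, $B_1$, $B_2$ be points in $\mathbb Z^2$ such that $A_1\prec A_2$, $B_1\prec B_2$ and $x_1+y_1=x_2+y_2$. Then, for all $m\ge0$, $$H^{\ge 2m+1}_{A_1\to B_2,A_2\to B_1}(t,q)=H^{\ge 2m}_{A_1\to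 B_2,A_2\to B_1}(t,q)=f_{2m,A_1,A_2,B_2,B_1}(t,q),$$ $$H^{\ge 2m+2}_{A_1\to B_1,A_2\to B_2}(t,q)=H^{\ge 2m+1}_{A_1\to B_1,A_2\to B_2}(t,q)=f_{2m+1,A_1,A_2,B_2,B_1}(t,q).$$ Let now $A$ and $B$ be points in $\mathbb Z^2$. Then, for all $r\ge0$, $$H^{\ge r}_{A\to B_1,A\to B_2}(t,q)=f_{r,A,A,B_2,B_1}(t,q),\qquad H^{\ge r}_{A_1\to B,A_2\to B}(t,q)=f_{r,A_1,A_2,B,B}(t,q),$$ $$H^{\ge r}_{A\to B,A\to B}(t,q)=\begin{cases}f_{0,A,A,B,B}(t,q)&\text{if }r=0,\\[2pt] 2\sum_{j\ge1}(-1)^{j-1}f_{r+j,A,A,B,B}(t,q)&\text{if }r\ge1.\end{cases}$$ -/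

import Mathlib

noncomputable section

namespace LatticePairs

/-- The two kinds of steps of a lattice path: `N = (0,1)` and `E = (1,0)`. -/
inductive Step where
  | N
  | E
  deriving DecidableEq

instance : Finite Step :=
  Finite.of_surjective (fun b : Bool => if b then Step.E else Step.N)
    (fun x => by cases x <;> simp)

/-- A lattice path with a given starting point is recorded by its word of steps. -/
abbrev Word := List Step

/-- The vertex number `i` (numbering from `0`) of the path that starts at `A` and has steps `w`. -/
def vertex (A : ℤ × ℤ) (w : Word) (i : ℕ) : ℤ × ℤ :=
  (A.1 + ((w.take i).count Step.E : ℤ), A.2 + ((w.take i).count Step.N : ℤ))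

/-- The set of lattice paths with steps `N` and `E` from `A` to `B`. -/
def paths (A B : ℤ × ℤ) : Set Word :=
  {w | vertex A w w.length = B}

/-- The positions of the descents (valleys) of a path: the numbers `i` such that vertex number `i`
is preceded by an `E` and followed by an `N`. -/
def descents (w : Word) : Finset ℕ :=
  (Finset.range w.length).filter
    (fun i => 0 < i ∧ w[i - 1]? = some Step.E ∧ w[i]? = some Step.N)

/-- The number of descents. -/
def des (w : Word) : ℕ := (descents w).card

/-- The major index: the sum of the positions of the descents. -/
def maj (w : Word) : ℕ := ∑ i ∈ descents w, i

/-- `V` is a crossing of the path `P` starting at `A₁` and the path `Q` starting at `A₂`.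
The sequence of common vertices `V_1, …, V_{s+1}` consists of the vertices number
`a + 1, …, a + 1 + s` of `P`, which are the vertices number `b + 1, …, b + 1 + s` of `Q`; none of
them is an endpoint of `P` or of `Q`; the sequence is maximal; for each of `P` and `Q`, the step
arriving at the first of these vertices is of the same type as the step leaving the last one;
and `V` is the last one. -/
def IsCrossing (A₁ A₂ : ℤ × ℤ) (P Q : Word) (V : ℤ × ℤ) : Prop :=
  ∃ a b s : ℕ,
    a + 1 + s < P.length ∧ b + 1 + s < Q.length ∧
    (∀ i ≤ s, vertex A₁ P (a + 1 + i) = vertex A₂ Q (b + 1 + i)) ∧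
    vertex A₁ P a ≠ vertex A₂ Q b ∧
    vertex A₁ P (a + 1 + s + 1) ≠ vertex A₂ Q (b + 1 + s + 1) ∧
    P[a]? = P[a + 1 + s]? ∧
    Q[b]? = Q[b + 1 + s]? ∧
    V = vertex A₁ P (a + 1 + s)

/-- The number of crossings of the path `P` starting at `A₁` and the path `Q` starting at `A₂`. -/
def cro (A₁ A₂ : ℤ × ℤ) (P Q : Word) : ℕ := {V | IsCrossing A₁ A₂ P Q V}.ncard

/-- The crossings form a finite set, so that `cro` counts them. -/
theorem finite_crossings (A₁ A₂ : ℤ × ℤ) (P Q : Word) :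
    {V | IsCrossing A₁ A₂ P Q V}.Finite := by
  refine ((Set.finite_Iio P.length).image (vertex A₁ P)).subset ?_
  rintro V ⟨a, b, s, h, -, -, -, -, -, -, rfl⟩
  exact ⟨a + 1 + s, h, rfl⟩

theorem finite_paths (A B : ℤ × ℤ) : (paths A B).Finite := by
  refine (List.finite_length_eq Step ((B.1 - A.1) + (B.2 - A.2)).toNat).subset ?_
  intro w hw
  have hlen : w.length = w.count Step.E + w.count Step.N := by
    clear hw
    induction w with
    | nil => simp
    | cons a l ih => cases a <;> simp <;> omega
  have hw' : vertex A w w.length = B := hw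
  simp only [vertex, List.take_length] at hw'
  subst hw'
  simp only [Set.mem_ofPred_eq]
  omega

/-- The set of pairs of paths `P` from `A₁` to `C₁` and `Q` from `A₂` to `C₂` that cross each other
at least `r` times. -/
def pairs (A₁ C₁ A₂ C₂ : ℤ × ℤ) (r : ℕ) : Set (Word × Word) :=
  {p | p.1 ∈ paths A₁ C₁ ∧ p.2 ∈ paths A₂ C₂ ∧ r ≤ cro A₁ A₂ p.1 p.2}

theorem finite_pairs (A₁ C₁ A₂ C₂ : ℤ × ℤ) (r : ℕ) : (pairs A₁ C₁ A₂ C₂ r).Finite :=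
  ((finite_paths A₁ C₁).prod (finite_paths A₂ C₂)).subset fun _ h => ⟨h.1, h.2.1⟩

/-- The variable `q`, in the field of rational functions `ℚ(q)`. -/
def q : RatFunc ℚ := RatFunc.X

/-- The variable `t`, in the polynomial ring `ℚ(q)[t]`. -/
def t : Polynomial (RatFunc ℚ) := Polynomial.X

/-- The polynomial `H^{≥ r}_{A₁ → C₁, A₂ → C₂}(t, q)`. -/
def H (r : ℕ) (A₁ C₁ A₂ C₂ : ℤ × ℤ) : Polynomial (RatFunc ℚ) :=
  ∑ p ∈ (finite_pairs A₁ C₁ A₂ C₂ r).toFinset,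
    t ^ (des p.1 + des p.2) * Polynomial.C (q ^ (maj p.1 + maj p.2))

/-- The `q`-binomial coefficient, which is `0` unless `0 ≤ n ≤ m`. -/
def qbin (m n : ℤ) : RatFunc ℚ :=
  if 0 ≤ n ∧ n ≤ m then
    (∏ i ∈ Finset.range n.toNat, (1 - q ^ (m - (i : ℤ)))) /
      (∏ i ∈ Finset.range n.toNat, (1 - q ^ (n - (i : ℤ))))
  else 0

/-- The sum `∑_{n ≥ 0} t^n q^{n(n+k)} [a choose n]_q [b choose n+k]_q`; only finitely many terms are
nonzero, see `finite_support_qsum`. -/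
def qsum (k a b : ℤ) : Polynomial (RatFunc ℚ) :=
  ∑ᶠ n : ℕ, t ^ n * Polynomial.C (q ^ ((n : ℤ) * (n + k)) * qbin a n * qbin b (n + k))

theorem finite_support_qsum (k a b : ℤ) :
    (Function.support fun n : ℕ =>
      t ^ n * Polynomial.C (q ^ ((n : ℤ) * (n + k)) * qbin a n * qbin b (n + k))).Finite := by
  refine (Set.finite_Iic a.toNat).subset ?_
  intro n hn
  by_contra h
  simp only [Set.mem_Iic] at h
  apply hn
  have : qbin a n = 0 := by
    unfold qbin
    rw [if_neg]
    omega
  simp [this]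

/-- The polynomial `f_{k, A₁, A₂, B₂, B₁}(t, q)`, with the points in this order. -/
def f (k : ℤ) (A₁ A₂ B₂ B₁ : ℤ × ℤ) : Polynomial (RatFunc ℚ) :=
  Polynomial.C (q ^ (k * (k + A₂.1 - A₁.1))) *
    qsum k (B₂.1 - A₁.1) (B₂.2 - A₁.2) *
    qsum (-k) (B₁.1 - A₂.1) (B₁.2 - A₂.2)

/-- `f_k` vanishes for large `k`, so that the alternating sums of the `f_k` are finite sums. -/
theorem f_eq_zero (k : ℤ) (A₁ A₂ B₂ B₁ : ℤ × ℤ) (h : B₂.2 - A₁.2 < k) :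
    f k A₁ A₂ B₂ B₁ = 0 := by
  have : qsum k (B₂.1 - A₁.1) (B₂.2 - A₁.2) = 0 := by
    unfold qsum
    apply finsum_eq_zero_of_forall_eq_zero
    intro n
    have : qbin (B₂.2 - A₁.2) (n + k) = 0 := by
      unfold qbin
      rw [if_neg]
      omega
    simp [this]
  simp [f, this]

theorem finite_support_alternating (r : ℕ) (A₁ A₂ B₂ B₁ : ℤ × ℤ) :
    (Function.support fun j : ℕ =>
      (-1 : Polynomial (RatFunc ℚ)) ^ j * f ((r : ℤ) + j + 1) A₁ A₂ B₂ B₁).Finite := by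
  refine (Set.finite_Iic (B₂.2 - A₁.2).toNat).subset ?_
  intro j hj
  by_contra h
  simp only [Set.mem_Iic] at h
  apply hj
  have : f ((r : ℤ) + j + 1) A₁ A₂ B₂ B₁ = 0 := f_eq_zero _ _ _ _ _ (by omega)
  simp [this]

/-- `A ≺ B`: the point `A` lies strictly to the left of and strictly above the point `B`. -/
def Prec (A B : ℤ × ℤ) : Prop := A.1 < B.1 ∧ B.2 < A.2

end LatticePairs

end

noncomputable section

namespace LatticePairs

/-! The starting points lie on one antidiagonal, so two paths meet only at vertices with equal
numbers, and `gap` records their horizontal distance there. A crossing is a sign change of `gap`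
across a run of zeros. The proof counts `sideChanges` instead, pretending that the first path starts
above the second: this is `cro`, plus one if the first nonzero gap is negative (`sideChanges_eq`).
Its parity tells which path is above at the end, so distinct end points with a known order determine
it.

The heart is `pairSum_eq_f`: pairs with at least r side changes have generating function f_r,
provided the end points are ordered as the parity of r requires, or coincide. The proof is by
induction on r. In the required order the last step of a path cannot produce the r-th side change,
so it can be removed; since a final E costs nothing and an N after an E contributes t q^i, this
gives a recursion in each end point. If the end points coincide, both last steps are removed. Pairs
that are then in the opposite order have a number of side changes of such parity that "at least r"
means "at least r - 1"; this is where f_{r-1} enters. The recursions, collected in `Sol`, have at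
most one solution (`Sol.unique`), and the q-Pascal rule shows that f_r is one (`sol_f`).

It remains to return to crossings. For distinct starting points both counts agree. For a common
starting point and distinct end points, parity makes the possible difference of one harmless. If
everything is common, averaging over the two orders of the pair gives H_r + H_{r+1} = 2 f_{r+1} for
r ≥ 1, and this telescopes. -/

/-! ### The q-Pascal rule and recursions for `qsum`. -/

theorem one_sub_q_zpow_ne_zero {n : ℤ} (hn : 0 < n) : (1 : RatFunc ℚ) - q ^ n ≠ 0 := by
  lift n to ℕ using hn.le
  have hn' : n ≠ 0 := by rintro rfl; simp at hn
  rw [zpow_natCast, sub_ne_zero]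
  intro h
  have h1 : algebraMap (Polynomial ℚ) (RatFunc ℚ) (Polynomial.X ^ n) =
      algebraMap (Polynomial ℚ) (RatFunc ℚ) 1 := by
    rw [map_pow, RatFunc.algebraMap_X, map_one]; exact h.symm
  have h2 := congrArg Polynomial.natDegree (RatFunc.algebraMap_injective ℚ h1)
  simp at h2
  exact hn' h2

theorem q_ne_zero : (q : RatFunc ℚ) ≠ 0 := RatFunc.X_ne_zero

theorem qbin_of_not {m n : ℤ} (h : ¬(0 ≤ n ∧ n ≤ m)) : qbin m n = 0 := if_neg h

theorem qbin_zero {m : ℤ} (h : 0 ≤ m) : qbin m 0 = 1 := by simp [qbin, h]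

/-- The numerator of the `q`-binomial coefficient. -/
def qfall (m : ℤ) (n : ℕ) : RatFunc ℚ := ∏ i ∈ Finset.range n, (1 - q ^ (m - (i : ℤ)))

theorem qfall_ne_zero {m : ℤ} {n : ℕ} (h : (n : ℤ) ≤ m) : qfall m n ≠ 0 := by
  refine Finset.prod_ne_zero_iff.2 fun i hi => one_sub_q_zpow_ne_zero ?_
  have := Finset.mem_range.1 hi
  omega

theorem qfall_succ (m : ℤ) (n : ℕ) : qfall m (n + 1) = qfall m n * (1 - q ^ (m - n)) :=
  Finset.prod_range_succ _ _

theorem qfall_succ' (m : ℤ) (n : ℕ) : qfall m (n + 1) = (1 - q ^ m) * qfall (m - 1) n := by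
  unfold qfall
  rw [Finset.prod_range_succ', mul_comm]
  congr 1
  · simp
  · refine Finset.prod_congr rfl fun i _ => ?_
    congr 2
    push_cast
    ring

theorem qbin_eq_qfall {m : ℤ} {n : ℕ} (h : (n : ℤ) ≤ m) : qbin m n = qfall m n / qfall n n := by
  rw [qbin, if_pos ⟨by omega, h⟩]
  simp [qfall]

theorem qbin_self {m : ℤ} (h : 0 ≤ m) : qbin m m = 1 := by
  lift m to ℕ using h
  rw [qbin_eq_qfall le_rfl]
  exact div_self (qfall_ne_zero le_rfl)

/-- The case `b = 0` fails at `m = 0`: the left side is 1, but both terms on the right have a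
negative upper index. -/
theorem qbin_pascal {b : ℤ} (hb : b ≠ 0) (m : ℤ) :
    qbin b m = qbin (b - 1) m + q ^ (b - m) * qbin (b - 1) (m - 1) := by
  rcases lt_or_ge m 0 with hm | hm
  · rw [qbin_of_not, qbin_of_not, qbin_of_not] <;> first | omega | simp
  rcases lt_or_ge b m with hbm | hbm
  · rw [qbin_of_not, qbin_of_not, qbin_of_not] <;> first | omega | simp
  rcases hm.eq_or_lt with rfl | hm
  · rw [qbin_zero hbm, qbin_zero (by omega), qbin_of_not (n := 0 - 1) (by omega)]
    simp
  rcases hbm.eq_or_lt with rfl | hbm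
  · rw [qbin_self hm.le, qbin_self (by omega), qbin_of_not (by omega)]
    simp
  obtain ⟨n, rfl⟩ : ∃ n : ℕ, m = (n : ℤ) + 1 := ⟨(m - 1).toNat, by omega⟩
  have e : ((n : ℤ) + 1) = ((n + 1 : ℕ) : ℤ) := by push_cast; ring
  rw [show (n : ℤ) + 1 - 1 = n by ring, qbin_eq_qfall (m := b - 1) (n := n) (by omega), e,
    qbin_eq_qfall (by omega), qbin_eq_qfall (by omega), qfall_succ' b, qfall_succ (b - 1),
    qfall_succ' ((n + 1 : ℕ) : ℤ)]
  have h1 : qfall n n ≠ 0 := qfall_ne_zero le_rfl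
  have h2 : (1 : RatFunc ℚ) - q ^ (((n + 1 : ℕ) : ℤ)) ≠ 0 := one_sub_q_zpow_ne_zero (by omega)
  rw [show (((n + 1 : ℕ) : ℤ)) - 1 = n by push_cast; ring,
    show b - 1 - (n : ℤ) = b - ((n + 1 : ℕ) : ℤ) by push_cast; ring]
  -- With q^b written as u v, the claim becomes a rational identity in u and v.
  have h3 : (q : RatFunc ℚ) ^ b = q ^ (b - ((n + 1 : ℕ) : ℤ)) * q ^ (((n + 1 : ℕ) : ℤ)) := by
    rw [← zpow_add₀ q_ne_zero]; congr 1; ring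
  rw [h3]
  generalize (q : RatFunc ℚ) ^ (b - ((n + 1 : ℕ) : ℤ)) = u at *
  generalize (q : RatFunc ℚ) ^ (((n + 1 : ℕ) : ℤ)) = v at *
  field_simp
  ring

theorem coeff_qsum (k a b : ℤ) (n : ℕ) :
    (qsum k a b).coeff n = q ^ ((n : ℤ) * (n + k)) * qbin a n * qbin b (n + k) := by
  rw [qsum, finsum_eq_sum_of_support_subset (s := (finite_support_qsum k a b).toFinset) _ (by simp),
    Polynomial.finsetSum_coeff]
  simp only [t, Polynomial.coeff_X_pow_mul', Polynomial.coeff_C]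
  rw [Finset.sum_eq_single n]
  · simp
  · intro m _ hm
    split_ifs <;> first | rfl | omega
  · intro h
    simp only [Set.Finite.mem_toFinset, Function.mem_support, not_not] at h
    have := congrArg (fun p => Polynomial.coeff p n) h
    simpa [t, Polynomial.coeff_X_pow_mul'] using this

theorem qsum_eq_zero_of_left {k a b : ℤ} (h : a < 0 ∨ a < -k) : qsum k a b = 0 := by
  ext n
  rw [coeff_qsum, Polynomial.coeff_zero]
  by_cases h1 : (n : ℤ) ≤ a
  · rw [qbin_of_not (m := b) (by omega), mul_zero]
  · rw [qbin_of_not (m := a) (by omega), mul_zero, zero_mul]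

theorem qsum_eq_zero_of_right {k a b : ℤ} (h : b < 0 ∨ b < k) : qsum k a b = 0 := by
  ext n
  rw [coeff_qsum, Polynomial.coeff_zero, qbin_of_not (m := b) (by omega), mul_zero]

/-- The q-Pascal rule for the first factor; reindexing n as n + 1 in its second term costs a factor
t and raises `k`. -/
theorem qsum_sub_left {a : ℤ} (ha : a ≠ 0) (k b : ℤ) :
    qsum k a b = qsum k (a - 1) b + t * Polynomial.C (q ^ (a + k)) * qsum (k + 1) (a - 1) b := by
  ext n
  rw [Polynomial.coeff_add, mul_assoc, t]
  rcases n with _ | n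
  · rw [Polynomial.coeff_X_mul_zero, coeff_qsum, coeff_qsum]
    have := qbin_pascal ha 0
    rw [qbin_of_not (n := 0 - 1) (by omega)] at this
    simp [this]
  · rw [Polynomial.coeff_X_mul, Polynomial.coeff_C_mul, coeff_qsum, coeff_qsum, coeff_qsum,
      qbin_pascal ha]
    have h : (q : RatFunc ℚ) ^ (((n + 1 : ℕ) : ℤ) * ((n + 1 : ℕ) + k)) * q ^ (a - ((n + 1 : ℕ) : ℤ))
        = q ^ (a + k) * q ^ ((n : ℤ) * (n + (k + 1))) := by
      rw [← zpow_add₀ q_ne_zero, ← zpow_add₀ q_ne_zero]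
      congr 1
      push_cast
      ring
    rw [show (((n + 1 : ℕ) : ℤ)) - 1 = n by push_cast; ring,
      show (n : ℤ) + (k + 1) = ((n + 1 : ℕ) : ℤ) + k by push_cast; ring] at *
    linear_combination (qbin (a - 1) n * qbin b (((n + 1 : ℕ) : ℤ) + k)) * h

theorem qsum_sub_right {b : ℤ} (hb : b ≠ 0) (k a : ℤ) :
    qsum k a b = qsum k a (b - 1) + Polynomial.C (q ^ (b - k)) * qsum (k - 1) a (b - 1) := by
  ext n
  rw [Polynomial.coeff_add, Polynomial.coeff_C_mul, coeff_qsum, coeff_qsum, coeff_qsum,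
    qbin_pascal hb]
  have h : (q : RatFunc ℚ) ^ ((n : ℤ) * (n + k)) * q ^ (b - (n + k))
        = q ^ (b - k) * q ^ ((n : ℤ) * (n + (k - 1))) := by
    rw [← zpow_add₀ q_ne_zero, ← zpow_add₀ q_ne_zero]
    congr 1
    ring
  rw [show (n : ℤ) + (k - 1) = n + k - 1 by ring] at *
  linear_combination (qbin a n * qbin (b - 1) (n + k - 1)) * h

/-- The monomial `t q^n`. -/
def tq (n : ℤ) : Polynomial (RatFunc ℚ) := t * Polynomial.C (q ^ n)

theorem C_q_zpow_add (m n : ℤ) :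
    Polynomial.C ((q : RatFunc ℚ) ^ (m + n)) = Polynomial.C (q ^ m) * Polynomial.C (q ^ n) := by
  rw [zpow_add₀ q_ne_zero, map_mul]

/-- Lower `a` at `b` and at `b - 1`, then lower `b` in the correction term, which brings `k + 1`
back to `k`. At `b = 0` the last move is unavailable, but for `0 ≤ k` the terms concerned vanish. -/
theorem qsum_rec_of_nonneg {k a : ℤ} (hk : 0 ≤ k) (ha : a ≠ 0) (b : ℤ) :
    qsum k a b = qsum k (a - 1) b + qsum k a (b - 1) +
      (tq (a + b - 1) - 1) * qsum k (a - 1) (b - 1) := by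
  rw [qsum_sub_left ha k b, qsum_sub_left ha k (b - 1)]
  by_cases hb : b = 0
  · rw [qsum_eq_zero_of_right (k := k + 1) (b := b) (by omega),
      qsum_eq_zero_of_right (k := k) (b := b - 1) (by omega),
      qsum_eq_zero_of_right (k := k + 1) (b := b - 1) (by omega)]
    simp
  · rw [qsum_sub_right hb (k + 1), show k + 1 - 1 = k by ring]
    have h := C_q_zpow_add (a + k) (b - (k + 1))
    rw [show a + k + (b - (k + 1)) = a + b - 1 by ring] at h
    rw [tq, h]
    ring

theorem qsum_rec_of_nonpos {k b : ℤ} (hk : k ≤ 0) (hb : b ≠ 0) (a : ℤ) :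
    qsum k a b = qsum k (a - 1) b + qsum k a (b - 1) +
      (tq (a + b - 1) - 1) * qsum k (a - 1) (b - 1) := by
  rw [qsum_sub_right hb k a, qsum_sub_right hb k (a - 1)]
  by_cases ha : a = 0
  · rw [qsum_eq_zero_of_left (k := k - 1) (a := a) (by omega),
      qsum_eq_zero_of_left (k := k) (a := a - 1) (by omega),
      qsum_eq_zero_of_left (k := k - 1) (a := a - 1) (by omega)]
    simp
  · rw [qsum_sub_left ha (k - 1), show k - 1 + 1 = k by ring]
    have h := C_q_zpow_add (b - k) (a + (k - 1))
    rw [show b - k + (a + (k - 1)) = a + b - 1 by ring] at h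
    rw [tq, h]
    ring

/-! ### The system of recursions, its uniqueness, and the solution f_k. -/

/-- The recursions, in the region where `(ux, uy)` lies weakly to the left of and weakly above
`(vx, vy)`, that determine a function of these two points. -/
structure Sol (a : ℤ) (ρ : ℤ → ℤ → Polynomial (RatFunc ℚ))
    (F : ℤ → ℤ → ℤ → ℤ → Polynomial (RatFunc ℚ)) : Prop where
  zero : ∀ ux uy vx vy, ux + uy < a ∨ vx + vy < a → F ux uy vx vy = 0
  left : ∀ ux uy vx vy, ux ≤ vx → vy < uy → F ux uy vx vy =
    F (ux - 1) uy vx vy + F ux (uy - 1) vx vy +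
      (tq (ux + uy - a - 1) - 1) * F (ux - 1) (uy - 1) vx vy
  right : ∀ ux uy vx vy, ux < vx → vy ≤ uy → F ux uy vx vy =
    F ux uy (vx - 1) vy + F ux uy vx (vy - 1) +
      (tq (vx + vy - a - 1) - 1) * F ux uy (vx - 1) (vy - 1)
  -- For path sums, `ρ x y` stands for the pairs whose last steps leave the region, so the left side
  -- is the contribution of pairs both ending in N; the right side splits it by the steps before.
  diag : ∀ x y, F x y x y - F (x - 1) y x y - ρ x y =
    (F x (y - 1) x (y - 1) - F (x - 1) (y - 1) x (y - 1) - ρ x (y - 1)) +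
      tq (x + y - a - 1) *
        (F (x - 1) (y - 1) x (y - 1) - F (x - 1) (y - 1) (x - 1) (y - 1) + ρ x (y - 1)) +
      tq (x + y - a - 1) ^ 2 * F (x - 1) (y - 1) (x - 1) (y - 1)

/-- Every recursion lowers the total length and stays in the region: `left` applies if the heights
differ, `right` if only the abscissas differ, `diag` if the points coincide. -/
theorem Sol.unique {a : ℤ} {ρ : ℤ → ℤ → Polynomial (RatFunc ℚ)}
    {F G : ℤ → ℤ → ℤ → ℤ → Polynomial (RatFunc ℚ)} (hF : Sol a ρ F) (hG : Sol a ρ G)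
    {ux uy vx vy : ℤ} (hx : ux ≤ vx) (hy : vy ≤ uy) : F ux uy vx vy = G ux uy vx vy := by
  suffices h : ∀ n : ℕ, ∀ ux uy vx vy : ℤ, ux ≤ vx → vy ≤ uy → ux + uy + vx + vy - 2 * a < n →
      F ux uy vx vy = G ux uy vx vy from
    h ((ux + uy + vx + vy - 2 * a).toNat + 1) _ _ _ _ hx hy (by omega)
  intro n
  induction n with
  | zero =>
    intro ux uy vx vy _ _ h
    have h' : ux + uy < a ∨ vx + vy < a := by push_cast at h; omega
    rw [hF.zero _ _ _ _ h', hG.zero _ _ _ _ h']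
  | succ n ih =>
    intro ux uy vx vy hx hy h
    push_cast at h
    rcases hy.lt_or_eq with hy' | rfl
    · rw [hF.left _ _ _ _ hx hy', hG.left _ _ _ _ hx hy', ih (ux - 1) uy, ih ux (uy - 1),
        ih (ux - 1) (uy - 1)] <;> omega
    rcases hx.lt_or_eq with hx' | rfl
    · rw [hF.right _ _ _ _ hx' hy, hG.right _ _ _ _ hx' hy, ih _ _ (vx - 1), ih _ _ vx (vy - 1),
        ih _ _ (vx - 1) (vy - 1)] <;> omega
    have h1 := hF.diag ux vy
    have h2 := hG.diag ux vy
    rw [ih (ux - 1) vy ux vy (by omega) (by omega) (by omega),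
      ih ux (vy - 1) ux (vy - 1) (by omega) (by omega) (by omega),
      ih (ux - 1) (vy - 1) ux (vy - 1) (by omega) (by omega) (by omega),
      ih (ux - 1) (vy - 1) (ux - 1) (vy - 1) (by omega) (by omega) (by omega)] at h1
    linear_combination h1 - h2

theorem f_def (k x₁ y₁ x₂ y₂ vx vy ux uy : ℤ) :
    f k (x₁, y₁) (x₂, y₂) (vx, vy) (ux, uy) = Polynomial.C (q ^ (k * (k + x₂ - x₁))) *
      qsum k (vx - x₁) (vy - y₁) * qsum (-k) (ux - x₂) (uy - y₂) := rfl

/-- Each point occurs in only one factor of f_k, so `left` and `right` are recursions for `qsum`.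
Where these fail, the other factor vanishes because of the position of the starting points. Only
`diag` mixes k and k - 1. -/
theorem sol_f {x₁ y₁ x₂ y₂ : ℤ} (hx : x₁ ≤ x₂) (hxy : x₁ + y₁ = x₂ + y₂) {k : ℤ} (hk : 1 ≤ k) :
    Sol (x₁ + y₁)
      (fun x y => f (k - 1) (x₁, y₁) (x₂, y₂) (x, y) (x - 1, y) -
        f (k - 1) (x₁, y₁) (x₂, y₂) (x - 1, y) (x - 1, y))
      (fun ux uy vx vy => f k (x₁, y₁) (x₂, y₂) (vx, vy) (ux, uy)) where
  zero ux uy vx vy h := by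
    rw [f_def]
    rcases h with h | h
    · suffices e : qsum (-k) (ux - x₂) (uy - y₂) = 0 by rw [e, mul_zero]
      by_cases h' : ux - x₂ < 0
      · exact qsum_eq_zero_of_left (Or.inl h')
      · exact qsum_eq_zero_of_right (by omega)
    · suffices e : qsum k (vx - x₁) (vy - y₁) = 0 by rw [e, mul_zero, zero_mul]
      by_cases h' : vx - x₁ < 0
      · exact qsum_eq_zero_of_left (Or.inl h')
      · exact qsum_eq_zero_of_right (by omega)
  left ux uy vx vy h₁ h₂ := by
    simp only [f_def]
    by_cases h : uy - y₂ = 0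
    · rw [show qsum k (vx - x₁) (vy - y₁) = 0 from qsum_eq_zero_of_right (by omega)]
      simp
    · rw [qsum_rec_of_nonpos (k := -k) (by omega) h, sub_right_comm ux, sub_right_comm uy,
        show ux - x₂ + (uy - y₂) - 1 = ux + uy - (x₁ + y₁) - 1 by omega]
      ring
  right ux uy vx vy h₁ h₂ := by
    simp only [f_def]
    by_cases h : vx - x₁ = 0
    · rw [show qsum (-k) (ux - x₂) (uy - y₂) = 0 from qsum_eq_zero_of_left (by omega)]
      simp
    · rw [qsum_rec_of_nonneg (k := k) (by omega) h, sub_right_comm vx, sub_right_comm vy,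
        show vx - x₁ + (vy - y₁) - 1 = vx + vy - (x₁ + y₁) - 1 by omega]
      ring
  diag x y := by
    simp only [f_def, sub_right_comm x 1, sub_right_comm y 1]
    obtain ⟨a, ha⟩ : ∃ a, x - x₁ = a := ⟨_, rfl⟩
    obtain ⟨b, hb⟩ : ∃ b, y - y₁ = b := ⟨_, rfl⟩
    obtain ⟨c, hc⟩ : ∃ c, x - x₂ = c := ⟨_, rfl⟩
    obtain ⟨d, hd⟩ : ∃ d, y - y₂ = d := ⟨_, rfl⟩
    rw [ha, hb, hc, hd, show x + y - (x₁ + y₁) - 1 = a + b - 1 by omega]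
    by_cases hc0 : c ≤ 0
    · have e (i : ℤ) (hi : i ≤ 0) (j : ℤ) : qsum (-k) i j = 0 := qsum_eq_zero_of_left (by omega)
      have e' (j : ℤ) : qsum (-(k - 1)) (c - 1) j = 0 := qsum_eq_zero_of_left (by omega)
      simp only [e c hc0, e (c - 1) (by omega), e']
      ring
    by_cases hb0 : b ≤ 0
    · have e (i j : ℤ) (hj : j ≤ 0) : qsum k i j = 0 := qsum_eq_zero_of_right (by omega)
      have e' (i : ℤ) : qsum (k - 1) i (b - 1) = 0 := qsum_eq_zero_of_right (by omega)
      have e'' : qsum (k - 1) a b = qsum (k - 1) (a - 1) b := by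
        rw [qsum_sub_left (by omega), show k - 1 + 1 = k by ring, e _ _ hb0]
        ring
      simp only [e _ b hb0, e _ (b - 1) (by omega), e', e'']
      ring
    have L2 := qsum_rec_of_nonpos (k := -k) (b := d) (by omega) (by omega) c
    have L3 := qsum_rec_of_nonneg (k := k - 1) (a := a) (by omega) (by omega) b
    have D1 := qsum_sub_left (a := a) (by omega) (k - 1) (b - 1)
    have D2 := qsum_sub_right (b := b) (by omega) k a
    have D3 := qsum_sub_left (a := c) (by omega) (-k) (d - 1)
    have D4 := qsum_sub_right (b := d) (by omega) (-(k - 1)) (c - 1)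
    rw [show c + d - 1 = a + b - 1 by omega] at L2
    rw [show k - 1 + 1 = k by ring] at D1
    rw [show -k + 1 = -(k - 1) by ring] at D3
    rw [show -(k - 1) - 1 = -k by ring] at D4
    -- The powers of q match because `a + b = c + d`, the two starting points being on one
    -- antidiagonal. With these three relations the powers of q can be treated as independent
    -- letters.
    have S1 : Polynomial.C (q ^ (k * (k + x₂ - x₁))) * Polynomial.C (q ^ (b - k)) *
        (t * Polynomial.C (q ^ (c + -k))) =
        Polynomial.C (q ^ ((k - 1) * (k - 1 + x₂ - x₁))) * tq (a + b - 1) := by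
      rw [tq, mul_left_comm, ← C_q_zpow_add, ← C_q_zpow_add, mul_left_comm, ← C_q_zpow_add]
      congr 3
      obtain rfl : x₂ = x₁ + a - c := by omega
      ring
    have S2 : Polynomial.C (q ^ ((k - 1) * (k - 1 + x₂ - x₁))) *
        (t * Polynomial.C (q ^ (a + (k - 1)))) * Polynomial.C (q ^ (d - -(k - 1))) =
        Polynomial.C (q ^ (k * (k + x₂ - x₁))) * tq (a + b - 1) := by
      rw [tq, mul_left_comm, mul_assoc, ← C_q_zpow_add, ← C_q_zpow_add, mul_left_comm _ t,
        ← C_q_zpow_add]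
      congr 3
      obtain rfl : x₂ = x₁ + a - c := by omega
      obtain rfl : d = a + b - c := by omega
      ring
    have S3 : Polynomial.C (q ^ (k * (k + x₂ - x₁))) * Polynomial.C (q ^ (b - k)) =
        Polynomial.C (q ^ ((k - 1) * (k - 1 + x₂ - x₁))) * Polynomial.C (q ^ (d - -(k - 1))) := by
      rw [← C_q_zpow_add, ← C_q_zpow_add]
      congr 2
      obtain rfl : x₂ = x₁ + a - c := by omega
      obtain rfl : d = a + b - c := by omega
      ring
    generalize Polynomial.C (q ^ (k * (k + x₂ - x₁))) = C₀ at *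
    generalize Polynomial.C (q ^ ((k - 1) * (k - 1 + x₂ - x₁))) = C₁ at *
    generalize Polynomial.C (q ^ (b - k)) = u at *
    generalize t * Polynomial.C (q ^ (c + -k)) = v at *
    generalize t * Polynomial.C (q ^ (a + (k - 1))) = w at *
    generalize Polynomial.C (q ^ (d - -(k - 1))) = z at *
    generalize tq (a + b - 1) = τ at *
    generalize qsum k a b = gD at *
    generalize qsum k a (b - 1) = gX at *
    generalize qsum k (a - 1) (b - 1) = gO at *
    generalize qsum (-k) c d = hD at *
    generalize qsum (-k) c (d - 1) = hX at *
    generalize qsum (-k) (c - 1) (d - 1) = hO at *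
    generalize qsum (k - 1) a b = gD' at *
    generalize qsum (k - 1) a (b - 1) = gX' at *
    generalize qsum (k - 1) (a - 1) (b - 1) = gO' at *
    generalize qsum (-(k - 1)) (c - 1) d = hE' at *
    generalize qsum (-(k - 1)) (c - 1) (d - 1) = hO' at *
    linear_combination C₀ * gD * L2 - C₁ * hE' * L3 + C₀ * gD * D3 - C₁ * hE' * D1 -
      C₁ * (w * gO + τ * gO') * D4 + C₀ * (v * hO' + τ * hO) * D2 - C₀ * gX * D3 +
      C₁ * hO' * D1 - τ * C₁ * hO' * D1 + gX' * hO' * S1 - gO * hO * S2 + τ * hO * gX' * S3 +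
      C₁ * z * τ * hO * D1 + τ * hO * gO * S2 + C₁ * τ * hO' * D1

/-! ### Weights of paths and removal of the last step. -/

/-- The monomial by which a path contributes to the generating functions. -/
def wt (w : Word) : Polynomial (RatFunc ℚ) := t ^ des w * Polynomial.C (q ^ maj w)

theorem descents_concat_E (w : Word) : descents (w ++ [Step.E]) = descents w := by
  ext i
  simp only [descents, Finset.mem_filter, Finset.mem_range, List.length_append,
    List.length_singleton]
  rcases lt_trichotomy i w.length with h | rfl | h
  · rw [List.getElem?_append_left h, List.getElem?_append_left (by omega)]
    simp [h, h.trans (Nat.lt_succ_self _)]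
  · simp
  · constructor <;> rintro ⟨h, -⟩ <;> omega

theorem descents_concat_N (w : Word) : descents (w ++ [Step.N]) =
    if w.getLast? = some Step.E then insert w.length (descents w) else descents w := by
  ext i
  have key : i ∈ descents (w ++ [Step.N]) ↔
      i ∈ descents w ∨ (i = w.length ∧ w.getLast? = some Step.E) := by
    simp only [descents, Finset.mem_filter, Finset.mem_range, List.length_append,
      List.length_singleton]
    rcases lt_trichotomy i w.length with h | rfl | h
    · rw [List.getElem?_append_left h, List.getElem?_append_left (by omega)]
      simp [h, h.trans (Nat.lt_succ_self _), h.ne]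
    · rcases Nat.eq_zero_or_pos w.length with h0 | h0
      · simp [List.length_eq_zero_iff.1 h0]
      · rw [List.getElem?_append_left (by omega), List.getLast?_eq_getElem?]
        simp [h0]
    · constructor
      · rintro ⟨h, -⟩; omega
      · rintro (⟨h, -⟩ | ⟨h, -⟩) <;> omega
  rw [key]
  split_ifs with h <;> simp [h, or_comm]

theorem wt_concat_E (w : Word) : wt (w ++ [Step.E]) = wt w := by
  simp [wt, des, maj, descents_concat_E]

theorem wt_concat_N_of_ne {w : Word} (h : w.getLast? ≠ some Step.E) :
    wt (w ++ [Step.N]) = wt w := by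
  simp [wt, des, maj, descents_concat_N, h]

theorem wt_concat_N_of_eq {w : Word} (h : w.getLast? = some Step.E) :
    wt (w ++ [Step.N]) = tq w.length * wt w := by
  have h' : w.length ∉ descents w := by simp [descents]
  simp only [wt, des, maj, descents_concat_N, h, if_true, Finset.card_insert_of_notMem h',
    Finset.sum_insert h', tq, zpow_natCast, pow_add, map_mul, pow_one]
  ring

/-- The E ends at vertex number `w.length + 1`, which the N turns into a descent. -/
theorem wt_concat_E_N (w : Word) :
    wt (w ++ [Step.E] ++ [Step.N]) = tq (w.length + 1) * wt w := by
  rw [wt_concat_N_of_eq (by simp), wt_concat_E]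
  simp

theorem wt_concat_N_N (w : Word) : wt (w ++ [Step.N] ++ [Step.N]) = wt (w ++ [Step.N]) :=
  wt_concat_N_of_ne (by simp)

theorem count_E_add_count_N (w : Word) : w.count Step.E + w.count Step.N = w.length := by
  induction w with
  | nil => simp
  | cons a l ih => cases a <;> simp <;> omega

/-- The finite set of paths from `A` to `B`. -/
def pathsFinset (A B : ℤ × ℤ) : Finset Word := (finite_paths A B).toFinset

theorem mem_pathsFinset {A B : ℤ × ℤ} {w : Word} : w ∈ pathsFinset A B ↔
    A.1 + w.count Step.E = B.1 ∧ A.2 + w.count Step.N = B.2 := by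
  simp [pathsFinset, paths, vertex, Prod.ext_iff]

theorem mem_pathsFinset_iff_paths {A B : ℤ × ℤ} {w : Word} :
    w ∈ pathsFinset A B ↔ w ∈ paths A B := Set.Finite.mem_toFinset _

theorem length_of_mem_pathsFinset {A B : ℤ × ℤ} {w : Word} (h : w ∈ pathsFinset A B) :
    (w.length : ℤ) = B.1 + B.2 - (A.1 + A.2) := by
  have := count_E_add_count_N w
  rw [mem_pathsFinset] at h
  omega

theorem pathsFinset_eq_empty {A B : ℤ × ℤ} (h : B.1 + B.2 < A.1 + A.2) :
    pathsFinset A B = ∅ := by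
  refine Finset.eq_empty_of_forall_notMem fun w hw => ?_
  have := length_of_mem_pathsFinset hw
  omega

theorem concat_E_mem {A : ℤ × ℤ} {x y : ℤ} {w : Word} :
    w ++ [Step.E] ∈ pathsFinset A (x, y) ↔ w ∈ pathsFinset A (x - 1, y) := by
  simp only [mem_pathsFinset, List.count_append, List.count_singleton]
  simp
  omega

theorem concat_N_mem {A : ℤ × ℤ} {x y : ℤ} {w : Word} :
    w ++ [Step.N] ∈ pathsFinset A (x, y) ↔ w ∈ pathsFinset A (x, y - 1) := by
  simp only [mem_pathsFinset, List.count_append, List.count_singleton]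
  simp
  omega

theorem nil_mem {A B : ℤ × ℤ} : [] ∈ pathsFinset A B ↔ B = A := by
  simp [mem_pathsFinset, Prod.ext_iff, eq_comm]

/-- Decomposition of a sum over paths by the last step. -/
theorem sum_paths (A : ℤ × ℤ) (x y : ℤ) (F : Word → Polynomial (RatFunc ℚ)) :
    ∑ P ∈ pathsFinset A (x, y), F P = (if (x, y) = A then F [] else 0) +
      ∑ P ∈ pathsFinset A (x - 1, y), F (P ++ [Step.E]) +
      ∑ P ∈ pathsFinset A (x, y - 1), F (P ++ [Step.N]) := by
  classical
  have hE : Function.Injective fun w : Word => w ++ [Step.E] := List.append_left_injective _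
  have hN : Function.Injective fun w : Word => w ++ [Step.N] := List.append_left_injective _
  have h : pathsFinset A (x, y) = ((if (x, y) = A then {[]} else ∅) ∪
      (pathsFinset A (x - 1, y)).image fun w => w ++ [Step.E]) ∪
      (pathsFinset A (x, y - 1)).image fun w => w ++ [Step.N] := by
    ext w
    simp only [Finset.mem_union, Finset.mem_image, ← concat_E_mem, ← concat_N_mem]
    rcases List.eq_nil_or_concat w with rfl | ⟨v, s, rfl⟩
    · rw [nil_mem]
      split_ifs <;> simp_all
    · cases s <;> split_ifs <;> simp
  rw [h, Finset.sum_union, Finset.sum_union, Finset.sum_image hE.injOn, Finset.sum_image hN.injOn]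
  · split_ifs <;> simp
  · rw [Finset.disjoint_left]
    split_ifs <;> simp
  · rw [Finset.disjoint_left]
    split_ifs <;> simp +contextual [or_imp]

theorem sum_paths_of_nil {A : ℤ × ℤ} {x y : ℤ} {F : Word → Polynomial (RatFunc ℚ)}
    (h : (x, y) = A → F [] = 0) :
    ∑ P ∈ pathsFinset A (x, y), F P =
      ∑ P ∈ pathsFinset A (x - 1, y), F (P ++ [Step.E]) +
      ∑ P ∈ pathsFinset A (x, y - 1), F (P ++ [Step.N]) := by
  rw [sum_paths]
  split_ifs with h'
  · rw [h h', zero_add]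
  · rw [zero_add]

/-- The recursion for a sum over paths that are weighted, up to the usual monomial, by a function
that does not see the last step. -/
theorem sum_paths_rec {A : ℤ × ℤ} {x y : ℤ} {κ : Word → Polynomial (RatFunc ℚ)}
    (h0 : (x, y) = A → κ [] = 0)
    (hE : ∀ P ∈ pathsFinset A (x - 1, y), κ (P ++ [Step.E]) = κ P)
    (hN : ∀ P ∈ pathsFinset A (x, y - 1), κ (P ++ [Step.N]) = κ P)
    (hE' : ∀ P ∈ pathsFinset A (x - 1, y - 1), κ (P ++ [Step.E]) = κ P) :
    ∑ P ∈ pathsFinset A (x, y), κ P * wt P =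
      ∑ P ∈ pathsFinset A (x - 1, y), κ P * wt P + ∑ P ∈ pathsFinset A (x, y - 1), κ P * wt P +
      (tq (x + y - (A.1 + A.2) - 1) - 1) * ∑ P ∈ pathsFinset A (x - 1, y - 1), κ P * wt P := by
  rw [sum_paths_of_nil (fun h => by rw [h0 h, zero_mul]), add_assoc]
  congr 1
  · exact Finset.sum_congr rfl fun P hP => by rw [hE P hP, wt_concat_E]
  -- Paths ending in N are split once more. Compared with the same splitting of the sum up to `(x, y
  -- - 1)`, only the part with an E before the N differs, by a factor `tq`; this yields `tq - 1`.
  rw [Finset.sum_congr rfl fun P hP => by rw [hN P hP],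
    sum_paths A x (y - 1) fun P => κ P * wt (P ++ [Step.N]),
    sum_paths A x (y - 1) fun P => κ P * wt P, sub_mul, one_mul, Finset.mul_sum]
  have e1 : ∑ P ∈ pathsFinset A (x - 1, y - 1),
      κ (P ++ [Step.E]) * wt (P ++ [Step.E] ++ [Step.N]) =
      ∑ P ∈ pathsFinset A (x - 1, y - 1), tq (x + y - (A.1 + A.2) - 1) * (κ P * wt P) := by
    refine Finset.sum_congr rfl fun P hP => ?_
    rw [hE' P hP, wt_concat_E_N, length_of_mem_pathsFinset hP, mul_left_comm]
    congr 2
    ring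
  have e2 : ∑ P ∈ pathsFinset A (x - 1, y - 1), κ (P ++ [Step.E]) * wt (P ++ [Step.E]) =
      ∑ P ∈ pathsFinset A (x - 1, y - 1), κ P * wt P :=
    Finset.sum_congr rfl fun P hP => by rw [hE' P hP, wt_concat_E]
  simp only [wt_concat_N_N]
  rw [e1, e2, wt_concat_N_of_ne (by simp)]
  ring

/-! ### Sign changes of integer sequences. -/

/-- The number of sign changes among the first terms of an integer sequence, where vanishing terms
are skipped and a positive term is imagined in front; it is even as long as the last nonvanishing
term is positive. -/
def signChanges (δ : ℕ → ℤ) : ℕ → ℕ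
  | 0 => 0
  | n + 1 => if (0 < δ (n + 1) ∧ Odd (signChanges δ n)) ∨ (δ (n + 1) < 0 ∧ Even (signChanges δ n))
      then signChanges δ n + 1 else signChanges δ n

theorem signChanges_congr {δ δ' : ℕ → ℤ} {n : ℕ} (h : ∀ i ≤ n, δ i = δ' i) :
    signChanges δ n = signChanges δ' n := by
  induction n with
  | zero => rfl
  | succ n ih => rw [signChanges, signChanges, ih fun i hi => h i (by omega), h _ le_rfl]

theorem even_signChanges_of_pos {δ : ℕ → ℤ} {n : ℕ} (h : 0 < δ n) :
    Even (signChanges δ n) := by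
  cases n with
  | zero => exact Even.zero
  | succ n => rw [signChanges]; grind

theorem odd_signChanges_of_neg {δ : ℕ → ℤ} (h0 : 0 ≤ δ 0) {n : ℕ} (h : δ n < 0) :
    Odd (signChanges δ n) := by
  cases n with
  | zero => omega
  | succ n => rw [signChanges]; grind

/-- The last nonvanishing one of the terms up to number `n` has the sign of `ε`. -/
def LastSign (ε : ℤ) (δ : ℕ → ℤ) (n : ℕ) : Prop :=
  ∃ a ≤ n, 0 < ε * δ a ∧ ∀ i, a < i → i ≤ n → δ i = 0

theorem lastSign_succ {ε : ℤ} {δ : ℕ → ℤ} {n : ℕ} :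
    LastSign ε δ (n + 1) ↔ 0 < ε * δ (n + 1) ∨ (δ (n + 1) = 0 ∧ LastSign ε δ n) := by
  constructor
  · rintro ⟨a, ha, hpos, hz⟩
    rcases ha.eq_or_lt with rfl | ha
    · exact Or.inl hpos
    · exact Or.inr ⟨hz _ ha le_rfl, a, by omega, hpos, fun i h1 h2 => hz i h1 (by omega)⟩
  · rintro (h | ⟨h, a, ha, hpos, hz⟩)
    · exact ⟨n + 1, le_rfl, h, fun i h1 h2 => by omega⟩
    · refine ⟨a, by omega, hpos, fun i h1 h2 => ?_⟩
      rcases h2.eq_or_lt with rfl | h2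
      · exact h
      · exact hz i h1 (by omega)

/-- The parity of the count remembers the current side. Since `signChanges` never inspects `δ 0`, a
negative initial term has to be excluded. -/
theorem odd_signChanges_iff {δ : ℕ → ℤ} (h0 : 0 ≤ δ 0) (n : ℕ) :
    Odd (signChanges δ n) ↔ LastSign (-1) δ n := by
  induction n with
  | zero =>
    simp only [signChanges, LastSign]
    constructor
    · intro h; simp at h
    · rintro ⟨a, ha, h, -⟩
      obtain rfl : a = 0 := by omega
      omega
  | succ n ih =>
    rw [lastSign_succ, ← ih, signChanges]
    grind

theorem lastSign_trichotomy (δ : ℕ → ℤ) (n : ℕ) :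
    LastSign 1 δ n ∨ LastSign (-1) δ n ∨ ∀ i ≤ n, δ i = 0 := by
  induction n with
  | zero =>
    rcases lt_trichotomy (δ 0) 0 with h | h | h
    · exact Or.inr (Or.inl ⟨0, le_rfl, by omega, fun i _ _ => by omega⟩)
    · exact Or.inr (Or.inr fun i hi => by rwa [Nat.le_zero.1 hi])
    · exact Or.inl ⟨0, le_rfl, by omega, fun i _ _ => by omega⟩
  | succ n ih =>
    rw [lastSign_succ, lastSign_succ]
    rcases lt_trichotomy (δ (n + 1)) 0 with h | h | h
    · exact Or.inr (Or.inl (Or.inl (by omega)))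
    · rcases ih with ih | ih | ih
      · exact Or.inl (Or.inr ⟨h, ih⟩)
      · exact Or.inr (Or.inl (Or.inr ⟨h, ih⟩))
      · refine Or.inr (Or.inr fun i hi => ?_)
        rcases hi.eq_or_lt with rfl | hi
        · exact h
        · exact ih i (by omega)
    · exact Or.inl (Or.inl (by omega))

theorem not_lastSign_both {δ : ℕ → ℤ} {n : ℕ} (h1 : LastSign 1 δ n) (h2 : LastSign (-1) δ n) :
    False := by
  obtain ⟨a, ha, hpos, hz⟩ := h1
  obtain ⟨b, hb, hneg, hz'⟩ := h2
  rcases lt_trichotomy a b with h | rfl | h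
  · rw [hz b h hb] at hneg; omega
  · omega
  · rw [hz' a h ha] at hpos; omega

/-- Term number `j` is the last one of a maximal run of zeros at which the sequence changes its
sign. -/
def ChangesAt (δ : ℕ → ℤ) (j : ℕ) : Prop :=
  δ j = 0 ∧ ((LastSign (-1) δ j ∧ 0 < δ (j + 1)) ∨ (LastSign 1 δ j ∧ δ (j + 1) < 0))

theorem changesAt_neg {δ : ℕ → ℤ} {j : ℕ} : ChangesAt (fun i => -δ i) j ↔ ChangesAt δ j := by
  simp only [ChangesAt, LastSign]
  simp [or_comm]

open Classical in
/-- The number of sign changes across runs of zeros. -/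
def zeroChanges (δ : ℕ → ℤ) (n : ℕ) : ℕ := ((Finset.range n).filter (ChangesAt δ)).card

open Classical in
theorem zeroChanges_le (δ : ℕ → ℤ) (n : ℕ) : zeroChanges δ n ≤ n :=
  (Finset.card_le_card (Finset.filter_subset _ _)).trans (Finset.card_range n).le

theorem exists_changesAt {δ : ℕ → ℤ} {n : ℕ} (h : 0 < zeroChanges δ n) :
    ∃ j < n, ChangesAt δ j := by
  classical
  obtain ⟨j, hj⟩ := Finset.card_pos.1 h
  exact ⟨j, by simpa using hj⟩

theorem zeroChanges_neg (δ : ℕ → ℤ) (n : ℕ) : zeroChanges (fun i => -δ i) n = zeroChanges δ n := by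
  unfold zeroChanges
  congr 1
  ext j
  simp only [Finset.mem_filter, changesAt_neg]

/-- The first nonvanishing one of the terms up to number `n` is negative. -/
def FirstNeg (δ : ℕ → ℤ) (n : ℕ) : Prop := ∃ i ≤ n, δ i < 0 ∧ ∀ j < i, δ j = 0

-- Steps of size at most 1 cannot jump over 0, so each genuine sign change passes through a run of
-- zeros. The only other counted change is from the imagined positive term to a negative first
-- nonzero term.
open Classical in
theorem signChanges_eq {δ : ℕ → ℤ} (h0 : 0 ≤ δ 0) (n : ℕ)
    (h1 : ∀ i < n, |δ (i + 1) - δ i| ≤ 1) :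
    signChanges δ n = zeroChanges δ n + if FirstNeg δ n then 1 else 0 := by
  induction n with
  | zero =>
    have : ¬FirstNeg δ 0 := by
      rintro ⟨i, hi, h, -⟩
      obtain rfl : i = 0 := by omega
      omega
    simp [signChanges, zeroChanges, this]
  | succ n ih =>
    specialize ih fun i hi => h1 i (by omega)
    have hstep := abs_le.1 (h1 n (by omega))
    have hz : zeroChanges δ (n + 1) = zeroChanges δ n + if ChangesAt δ n then 1 else 0 := by
      rw [zeroChanges, Finset.range_add_one, Finset.filter_insert]
      split_ifs
      · rw [Finset.card_insert_of_notMem (by simp)]; rfl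
      · rfl
    have hF : FirstNeg δ (n + 1) ↔ FirstNeg δ n ∨ (δ (n + 1) < 0 ∧ ∀ j ≤ n, δ j = 0) := by
      constructor
      · rintro ⟨i, hi, h, hj⟩
        rcases hi.eq_or_lt with rfl | hi
        · exact Or.inr ⟨h, fun j hj' => hj j (by omega)⟩
        · exact Or.inl ⟨i, by omega, h, hj⟩
      · rintro (⟨i, hi, h, hj⟩ | ⟨h, hj⟩)
        · exact ⟨i, by omega, h, hj⟩
        · exact ⟨n + 1, le_rfl, h, fun j hj' => hj j (by omega)⟩
    have hodd := odd_signChanges_iff h0 n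
    have hzero : LastSign (-1) δ n → δ n ≤ 0 := by
      rintro ⟨a, ha, h, hz⟩
      rcases ha.eq_or_lt with rfl | ha
      · omega
      · exact (hz n ha le_rfl).le
    have hzero' : LastSign 1 δ n → 0 ≤ δ n := by
      rintro ⟨a, ha, h, hz⟩
      rcases ha.eq_or_lt with rfl | ha
      · omega
      · exact (hz n ha le_rfl).ge
    have hall : (∀ j ≤ n, δ j = 0) → ¬LastSign (-1) δ n ∧ ¬LastSign 1 δ n ∧ ¬FirstNeg δ n := by
      intro h
      refine ⟨?_, ?_, ?_⟩
      · rintro ⟨a, ha, h', -⟩; rw [h a ha] at h'; omega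
      · rintro ⟨a, ha, h', -⟩; rw [h a ha] at h'; omega
      · rintro ⟨a, ha, h', -⟩; rw [h a ha] at h'; omega
    have htri := lastSign_trichotomy δ n
    have hboth := @not_lastSign_both δ n
    rw [signChanges, hz]
    simp only [hF, ← Nat.not_odd_iff_even, hodd, ChangesAt]
    by_cases hp : LastSign 1 δ n
    · have hn : ¬LastSign (-1) δ n := fun h => hboth hp h
      have ha : ¬∀ j ≤ n, δ j = 0 := fun h => (hall h).2.1 hp
      have := hzero' hp
      by_cases hd : δ (n + 1) < 0
      · have : δ n = 0 := by omega
        simp [hp, hn, ha, hd, this, ih]; omega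
      · simp [hp, hn, ha, hd, ih]
    · by_cases hn : LastSign (-1) δ n
      · have ha : ¬∀ j ≤ n, δ j = 0 := fun h => (hall h).1 hn
        have := hzero hn
        by_cases hd : 0 < δ (n + 1)
        · have : δ n = 0 := by omega
          simp [hp, hn, ha, hd, this, ih]; omega
        · simp [hp, hn, ha, hd, ih]
      · have ha : ∀ j ≤ n, δ j = 0 := by tauto
        have hf := (hall ha).2.2
        by_cases hd : δ (n + 1) < 0
        · simp [hp, hn, hd, hf, ih, if_pos ha]
        · simp [hp, hn, hd, ih]

/-! ### Crossings as sign changes of the gap. -/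

/-- The horizontal distance of vertex number `i` of two paths. -/
def gap (A₁ A₂ : ℤ × ℤ) (P Q : Word) (i : ℕ) : ℤ := (vertex A₂ Q i).1 - (vertex A₁ P i).1

/-- The number of changes of sides of two paths, the first path being imagined to lie above the
second one at the beginning. -/
def sideChanges (A₁ A₂ : ℤ × ℤ) (P Q : Word) : ℕ :=
  signChanges (gap A₁ A₂ P Q) (min P.length Q.length)

theorem vertex_fst_succ {A : ℤ × ℤ} {w : Word} {i : ℕ} (h : i < w.length) :
    (vertex A w (i + 1)).1 = (vertex A w i).1 + if w[i]? = some Step.E then 1 else 0 := by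
  simp only [vertex, List.take_add_one, List.count_append]
  rw [List.getElem?_eq_getElem h]
  cases w[i] <;> simp [add_assoc]

theorem vertex_snd {A : ℤ × ℤ} {w : Word} {i : ℕ} (h : i ≤ w.length) :
    (vertex A w i).2 = A.1 + A.2 + i - (vertex A w i).1 := by
  have := count_E_add_count_N (w.take i)
  simp only [List.length_take, min_eq_left h] at this
  simp only [vertex]
  omega

theorem gap_succ_sub {A₁ A₂ : ℤ × ℤ} {P Q : Word} {i : ℕ} (hP : i < P.length)
    (hQ : i < Q.length) : gap A₁ A₂ P Q (i + 1) - gap A₁ A₂ P Q i =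
      (if Q[i]? = some Step.E then 1 else 0) - (if P[i]? = some Step.E then 1 else 0) := by
  rw [gap, gap, vertex_fst_succ hP, vertex_fst_succ hQ]
  ring

theorem vertex_eq_iff {A₁ A₂ : ℤ × ℤ} (hA : A₁.1 + A₁.2 = A₂.1 + A₂.2) {P Q : Word} {i j : ℕ}
    (hP : i ≤ P.length) (hQ : j ≤ Q.length) :
    vertex A₁ P i = vertex A₂ Q j ↔ i = j ∧ gap A₁ A₂ P Q i = 0 := by
  rw [Prod.ext_iff, vertex_snd hP, vertex_snd hQ, gap]
  constructor
  · rintro ⟨h1, h2⟩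
    obtain rfl : i = j := by omega
    exact ⟨rfl, by omega⟩
  · rintro ⟨rfl, h⟩
    constructor <;> omega

/-- A maximal run of common vertices is a maximal run of zeros of `gap`. Equal steps into and out of
the run change the gap by the same amount, so its sign flips; conversely, a nonzero change of the
gap determines both steps. -/
theorem isCrossing_iff {A₁ A₂ : ℤ × ℤ} (hA : A₁.1 + A₁.2 = A₂.1 + A₂.2) {P Q : Word} {V : ℤ × ℤ} :
    IsCrossing A₁ A₂ P Q V ↔ ∃ j < min P.length Q.length, ChangesAt (gap A₁ A₂ P Q) j ∧
      V = vertex A₁ P j := by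
  have getE (w : Word) (i : ℕ) (h : i < w.length) : w[i]? = some Step.E ∨ w[i]? = some Step.N := by
    rw [List.getElem?_eq_getElem h]
    cases w[i] <;> simp
  constructor
  · rintro ⟨a, b, s, hP, hQ, hcom, hne1, hne2, hs1, hs2, rfl⟩
    have h0 := hcom 0 (Nat.zero_le _)
    rw [vertex_eq_iff hA (by omega) (by omega)] at h0
    obtain rfl : a = b := by omega
    have hz : ∀ i ≤ s, gap A₁ A₂ P Q (a + 1 + i) = 0 := fun i hi =>
      ((vertex_eq_iff hA (by omega) (by omega)).1 (hcom i hi)).2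
    rw [Ne, vertex_eq_iff hA (by omega) (by omega)] at hne1 hne2
    have d1 := gap_succ_sub (A₁ := A₁) (A₂ := A₂) (P := P) (Q := Q) (i := a) (by omega) (by omega)
    have d2 := gap_succ_sub (A₁ := A₁) (A₂ := A₂) (P := P) (Q := Q) (i := a + 1 + s)
      (by omega) (by omega)
    rw [← hs1, ← hs2, hz s le_rfl] at d2
    rw [hz 0 (Nat.zero_le _)] at d1
    have hz' : ∀ i, a < i → i ≤ a + 1 + s → gap A₁ A₂ P Q i = 0 := fun i h1 h2 => by
      have := hz (i - (a + 1)) (by omega)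
      rwa [show a + 1 + (i - (a + 1)) = i by omega] at this
    refine ⟨a + 1 + s, by omega, ⟨hz s le_rfl, ?_⟩, rfl⟩
    -- The gap changes equally before and after the run of zeros.
    have hsum : gap A₁ A₂ P Q (a + 1 + s + 1) = -gap A₁ A₂ P Q a := by omega
    rcases lt_or_gt_of_ne (show gap A₁ A₂ P Q a ≠ 0 by tauto) with h | h
    · exact Or.inl ⟨⟨a, by omega, by omega, hz'⟩, by omega⟩
    · exact Or.inr ⟨⟨a, by omega, by omega, hz'⟩, by omega⟩
  · rintro ⟨j, hj, ⟨hz, h⟩, rfl⟩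
    rw [lt_min_iff] at hj
    have key : ∃ a < j, (∀ i, a < i → i ≤ j → gap A₁ A₂ P Q i = 0) ∧
        ((gap A₁ A₂ P Q a < 0 ∧ 0 < gap A₁ A₂ P Q (j + 1)) ∨
          (0 < gap A₁ A₂ P Q a ∧ gap A₁ A₂ P Q (j + 1) < 0)) := by
      rcases h with ⟨⟨a, ha, h, h'⟩, h''⟩ | ⟨⟨a, ha, h, h'⟩, h''⟩
      · refine ⟨a, lt_of_le_of_ne ha ?_, h', Or.inl ⟨by omega, h''⟩⟩
        rintro rfl; omega
      · refine ⟨a, lt_of_le_of_ne ha ?_, h', Or.inr ⟨by omega, h''⟩⟩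
        rintro rfl; omega
    obtain ⟨a, ha, h', h''⟩ := key
    obtain ⟨s, rfl⟩ : ∃ s, j = a + 1 + s := ⟨j - (a + 1), by omega⟩
    have d1 := gap_succ_sub (A₁ := A₁) (A₂ := A₂) (P := P) (Q := Q) (i := a) (by omega) (by omega)
    have d2 := gap_succ_sub (A₁ := A₁) (A₂ := A₂) (P := P) (Q := Q) (i := a + 1 + s)
      (by omega) (by omega)
    rw [h' (a + 1) (by omega) (by omega)] at d1
    rw [hz] at d2
    refine ⟨a, a, s, hj.1, hj.2, fun i hi => ?_, ?_, ?_, ?_, ?_, rfl⟩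
    · rw [vertex_eq_iff hA (by omega) (by omega)]
      exact ⟨rfl, h' _ (by omega) (by omega)⟩
    · rw [Ne, vertex_eq_iff hA (by omega) (by omega)]
      omega
    · rw [Ne, vertex_eq_iff hA (by omega) (by omega)]
      omega
    all_goals
      rcases getE P a (by omega) with e1 | e1 <;> rcases getE Q a (by omega) with e2 | e2 <;>
      rcases getE P (a + 1 + s) (by omega) with e3 | e3 <;>
      rcases getE Q (a + 1 + s) (by omega) with e4 | e4 <;>
      simp only [e1, e2, e3, e4] at d1 d2 ⊢ <;> simp at d1 d2 <;> omega

/-- The vertices of a path are distinct, so crossings may be counted by their numbers. -/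
theorem cro_eq_zeroChanges {A₁ A₂ : ℤ × ℤ} (hA : A₁.1 + A₁.2 = A₂.1 + A₂.2) (P Q : Word) :
    cro A₁ A₂ P Q = zeroChanges (gap A₁ A₂ P Q) (min P.length Q.length) := by
  classical
  have h : {V | IsCrossing A₁ A₂ P Q V} = vertex A₁ P '' (((Finset.range (min P.length Q.length)).filter
      (ChangesAt (gap A₁ A₂ P Q)) : Finset ℕ) : Set ℕ) := by
    ext V
    simp only [Set.mem_ofPred_eq, isCrossing_iff hA, Set.mem_image, Finset.coe_filter,
      Finset.mem_range]
    constructor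
    · rintro ⟨j, h1, h2, rfl⟩; exact ⟨j, ⟨h1, h2⟩, rfl⟩
    · rintro ⟨j, ⟨h1, h2⟩, rfl⟩; exact ⟨j, h1, h2, rfl⟩
  rw [cro, h, Set.InjOn.ncard_image, Set.ncard_coe_finset, zeroChanges]
  · intro i hi j hj hij
    simp only [Finset.coe_filter, Finset.mem_range, Set.mem_ofPred_eq, lt_min_iff] at hi hj
    exact ((vertex_eq_iff rfl hi.1.1.le hj.1.1.le).1 hij).1

open Classical in
theorem sideChanges_eq {A₁ A₂ : ℤ × ℤ} (hA : A₁.1 + A₁.2 = A₂.1 + A₂.2) (hx : A₁.1 ≤ A₂.1)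
    (P Q : Word) : sideChanges A₁ A₂ P Q = cro A₁ A₂ P Q +
      if FirstNeg (gap A₁ A₂ P Q) (min P.length Q.length) then 1 else 0 := by
  rw [sideChanges, cro_eq_zeroChanges hA, signChanges_eq]
  · simpa [gap, vertex] using hx
  · intro i hi
    rw [lt_min_iff] at hi
    rw [gap_succ_sub hi.1 hi.2]
    split_ifs <;> simp

/-! ### Effect of last steps on the number of side changes. -/

/-- Odd-numbered changes lead to the negative side, so a nonnegative term cannot be the place of
one. -/
theorem le_signChanges_succ_odd {δ : ℕ → ℤ} {n r : ℕ} (hr : Odd r) (h : 0 ≤ δ (n + 1)) :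
    r ≤ signChanges δ (n + 1) ↔ r ≤ signChanges δ n := by
  rw [signChanges]
  grind

theorem le_signChanges_succ_even {δ : ℕ → ℤ} {n r : ℕ} (hr : Even r) (h : δ (n + 1) ≤ 0) :
    r ≤ signChanges δ (n + 1) ↔ r ≤ signChanges δ n := by
  rw [signChanges]
  grind

theorem signChanges_succ_of_eq_zero {δ : ℕ → ℤ} {n : ℕ} (h : δ (n + 1) = 0) :
    signChanges δ (n + 1) = signChanges δ n := by
  simp [signChanges, h]

theorem vertex_concat {A : ℤ × ℤ} {w : Word} {s : Step} {i : ℕ} (h : i ≤ w.length) :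
    vertex A (w ++ [s]) i = vertex A w i := by
  simp [vertex, List.take_append_of_le_length h]

section

variable {A₁ A₂ : ℤ × ℤ} {P Q : Word} {s s' : Step} {x y x' y' : ℤ}

theorem sideChanges_concat_left_of_le (h : Q.length ≤ P.length) :
    sideChanges A₁ A₂ (P ++ [s]) Q = sideChanges A₁ A₂ P Q := by
  rw [sideChanges, sideChanges, min_eq_right h, min_eq_right (by simp; omega)]
  exact signChanges_congr fun i hi => by rw [gap, gap, vertex_concat (hi.trans h)]

theorem sideChanges_concat_right_of_le (h : P.length ≤ Q.length) :
    sideChanges A₁ A₂ P (Q ++ [s]) = sideChanges A₁ A₂ P Q := by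
  rw [sideChanges, sideChanges, min_eq_left h, min_eq_left (by simp; omega)]
  exact signChanges_congr fun i hi => by rw [gap, gap, vertex_concat (hi.trans h)]

theorem sideChanges_nil_left : sideChanges A₁ A₂ [] Q = 0 := by
  simp [sideChanges, signChanges]

theorem sideChanges_nil_right : sideChanges A₁ A₂ P [] = 0 := by
  simp [sideChanges, signChanges]

theorem vertex_length (h : P ∈ pathsFinset A₁ (x, y)) : vertex A₁ P P.length = (x, y) :=
  mem_pathsFinset_iff_paths.1 h

theorem vertex_le (h : P ∈ pathsFinset A₁ (x, y)) (i : ℕ) :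
    (vertex A₁ P i).1 ≤ x ∧ (vertex A₁ P i).2 ≤ y := by
  rw [mem_pathsFinset] at h
  have h1 := (List.take_sublist i P).count_le Step.E
  have h2 := (List.take_sublist i P).count_le Step.N
  simp only [vertex] at h ⊢
  omega

/-- At the end of the shorter path, the longer one has not yet passed either coordinate of its own
end point. -/
theorem gap_bounds_left (hA : A₁.1 + A₁.2 = A₂.1 + A₂.2) (hP : P ∈ pathsFinset A₁ (x, y))
    (hQ : Q ∈ pathsFinset A₂ (x', y')) (h : P.length ≤ Q.length) :
    y - y' ≤ gap A₁ A₂ P Q P.length ∧ gap A₁ A₂ P Q P.length ≤ x' - x := by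
  have h1 := vertex_length hP
  have h2 := vertex_le hQ P.length
  rw [vertex_snd h] at h2
  have h3 := length_of_mem_pathsFinset hP
  simp only [gap, h1] at h3 ⊢
  omega

theorem gap_bounds_right (hA : A₁.1 + A₁.2 = A₂.1 + A₂.2) (hP : P ∈ pathsFinset A₁ (x, y))
    (hQ : Q ∈ pathsFinset A₂ (x', y')) (h : Q.length ≤ P.length) :
    x' - x ≤ gap A₁ A₂ P Q Q.length ∧ gap A₁ A₂ P Q Q.length ≤ y - y' := by
  have h1 := vertex_length hQ
  have h2 := vertex_le hP Q.length
  rw [vertex_snd h] at h2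
  have h3 := length_of_mem_pathsFinset hQ
  simp only [gap, h1] at h3 ⊢
  omega

theorem sideChanges_concat_left_of_lt (h : P.length < Q.length) :
    sideChanges A₁ A₂ (P ++ [s]) Q = signChanges (gap A₁ A₂ (P ++ [s]) Q) (P.length + 1) ∧
    sideChanges A₁ A₂ P Q = signChanges (gap A₁ A₂ (P ++ [s]) Q) P.length := by
  rw [sideChanges, sideChanges, min_eq_left h.le, min_eq_left (by simp; omega)]
  refine ⟨by simp, signChanges_congr fun i hi => by rw [gap, gap, vertex_concat hi]⟩

theorem sideChanges_concat_right_of_lt (h : Q.length < P.length) :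
    sideChanges A₁ A₂ P (Q ++ [s]) = signChanges (gap A₁ A₂ P (Q ++ [s])) (Q.length + 1) ∧
    sideChanges A₁ A₂ P Q = signChanges (gap A₁ A₂ P (Q ++ [s])) Q.length := by
  rw [sideChanges, sideChanges, min_eq_right h.le, min_eq_right (by simp; omega)]
  refine ⟨by simp, signChanges_congr fun i hi => by rw [gap, gap, vertex_concat hi]⟩

/-- Either the new step lies beyond the end of `Q` and is not compared, or `gap_bounds_left` gives
the new gap the sign that rules out an `r`-th change. -/
theorem le_sideChanges_concat_left (hA : A₁.1 + A₁.2 = A₂.1 + A₂.2) {r : ℕ}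
    (hP : P ++ [s] ∈ pathsFinset A₁ (x, y)) (hQ : Q ∈ pathsFinset A₂ (x', y'))
    (h : (Odd r ∧ y' ≤ y) ∨ (Even r ∧ x' ≤ x)) :
    r ≤ sideChanges A₁ A₂ (P ++ [s]) Q ↔ r ≤ sideChanges A₁ A₂ P Q := by
  rcases le_or_gt Q.length P.length with hl | hl
  · rw [sideChanges_concat_left_of_le hl]
  obtain ⟨h1, h2⟩ := sideChanges_concat_left_of_lt (A₁ := A₁) (A₂ := A₂) (s := s) hl
  have hb := gap_bounds_left hA hP hQ (by simp; omega)
  rw [List.length_append, List.length_singleton] at hb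
  rw [h1, h2]
  rcases h with ⟨hr, h⟩ | ⟨hr, h⟩
  · exact le_signChanges_succ_odd hr (by omega)
  · exact le_signChanges_succ_even hr (by omega)

theorem le_sideChanges_concat_right (hA : A₁.1 + A₁.2 = A₂.1 + A₂.2) {r : ℕ}
    (hP : P ∈ pathsFinset A₁ (x, y)) (hQ : Q ++ [s] ∈ pathsFinset A₂ (x', y'))
    (h : (Odd r ∧ x ≤ x') ∨ (Even r ∧ y ≤ y')) :
    r ≤ sideChanges A₁ A₂ P (Q ++ [s]) ↔ r ≤ sideChanges A₁ A₂ P Q := by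
  rcases le_or_gt P.length Q.length with hl | hl
  · rw [sideChanges_concat_right_of_le hl]
  obtain ⟨h1, h2⟩ := sideChanges_concat_right_of_lt (A₁ := A₁) (A₂ := A₂) (s := s) hl
  have hb := gap_bounds_right hA hP hQ (by simp; omega)
  rw [List.length_append, List.length_singleton] at hb
  rw [h1, h2]
  rcases h with ⟨hr, h⟩ | ⟨hr, h⟩
  · exact le_signChanges_succ_odd hr (by omega)
  · exact le_signChanges_succ_even hr (by omega)

/-- The only new gap is at the common end point, where it is zero. -/
theorem sideChanges_concat_concat (hA : A₁.1 + A₁.2 = A₂.1 + A₂.2)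
    (hP : P ++ [s] ∈ pathsFinset A₁ (x, y)) (hQ : Q ++ [s'] ∈ pathsFinset A₂ (x, y)) :
    sideChanges A₁ A₂ (P ++ [s]) (Q ++ [s']) = sideChanges A₁ A₂ P Q := by
  have h1 := length_of_mem_pathsFinset hP
  have h2 := length_of_mem_pathsFinset hQ
  simp only [List.length_append, List.length_singleton, Nat.cast_add, Nat.cast_one] at h1 h2
  have hl : P.length = Q.length := by omega
  obtain ⟨h3, h4⟩ := sideChanges_concat_left_of_lt (A₁ := A₁) (A₂ := A₂) (s := s) (P := P)
    (Q := Q ++ [s']) (by simp; omega)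
  have hb := gap_bounds_left hA hP hQ (by simp; omega)
  rw [List.length_append, List.length_singleton] at hb
  rw [h3, signChanges_succ_of_eq_zero (by omega), ← h4, sideChanges_concat_right_of_le hl.le]

theorem even_sideChanges (hA : A₁.1 + A₁.2 = A₂.1 + A₂.2)
    (hP : P ∈ pathsFinset A₁ (x, y)) (hQ : Q ∈ pathsFinset A₂ (x', y')) (hx : x < x')
    (hy : y' < y) : Even (sideChanges A₁ A₂ P Q) := by
  rcases le_total P.length Q.length with hl | hl
  · have hb := gap_bounds_left hA hP hQ hl
    rw [sideChanges, min_eq_left hl]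
    exact even_signChanges_of_pos (by omega)
  · have hb := gap_bounds_right hA hP hQ hl
    rw [sideChanges, min_eq_right hl]
    exact even_signChanges_of_pos (by omega)

theorem gap_zero : gap A₁ A₂ P Q 0 = A₂.1 - A₁.1 := by simp [gap, vertex]

theorem odd_sideChanges (hA : A₁.1 + A₁.2 = A₂.1 + A₂.2) (hx₀ : A₁.1 ≤ A₂.1)
    (hP : P ∈ pathsFinset A₁ (x, y)) (hQ : Q ∈ pathsFinset A₂ (x', y')) (hx : x' < x)
    (hy : y < y') : Odd (sideChanges A₁ A₂ P Q) := by
  rcases le_total P.length Q.length with hl | hl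
  · have hb := gap_bounds_left hA hP hQ hl
    rw [sideChanges, min_eq_left hl]
    exact odd_signChanges_of_neg (by rw [gap_zero]; omega) (by omega)
  · have hb := gap_bounds_right hA hP hQ hl
    rw [sideChanges, min_eq_right hl]
    exact odd_signChanges_of_neg (by rw [gap_zero]; omega) (by omega)

end

/-! ### Recursions for the generating functions by side changes. -/

/-- The generating function of the pairs of paths with at least `r` changes of sides, where steps
`s` and `s'` are appended to the two paths. -/
def stepSum (A₁ A₂ : ℤ × ℤ) (r : ℕ) (C₁ C₂ : ℤ × ℤ) (s s' : Step) : Polynomial (RatFunc ℚ) :=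
  ∑ P ∈ pathsFinset A₁ C₁, ∑ Q ∈ pathsFinset A₂ C₂,
    if r ≤ sideChanges A₁ A₂ P Q then wt (P ++ [s]) * wt (Q ++ [s']) else 0

/-- The generating function of the pairs of paths with at least `r` changes of sides. -/
def pairSum (A₁ A₂ : ℤ × ℤ) (r : ℕ) (C₁ C₂ : ℤ × ℤ) : Polynomial (RatFunc ℚ) :=
  ∑ P ∈ pathsFinset A₁ C₁, ∑ Q ∈ pathsFinset A₂ C₂,
    if r ≤ sideChanges A₁ A₂ P Q then wt P * wt Q else 0

section

variable {A₁ A₂ : ℤ × ℤ} {r : ℕ}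

theorem pairSum_eq_zero {C₁ C₂ : ℤ × ℤ} (h : C₁.1 + C₁.2 < A₁.1 + A₁.2 ∨ C₂.1 + C₂.2 < A₂.1 + A₂.2) :
    pairSum A₁ A₂ r C₁ C₂ = 0 := by
  rw [pairSum]
  rcases h with h | h <;> simp [pathsFinset_eq_empty h]

theorem pairSum_rec_left (hA : A₁.1 + A₁.2 = A₂.1 + A₂.2) (hr : 1 ≤ r) {x y x' y' : ℤ}
    (h : (Odd r ∧ y' < y) ∨ (Even r ∧ x' ≤ x)) :
    pairSum A₁ A₂ r (x, y) (x', y') = pairSum A₁ A₂ r (x - 1, y) (x', y') +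
      pairSum A₁ A₂ r (x, y - 1) (x', y') +
      (tq (x + y - (A₁.1 + A₁.2) - 1) - 1) * pairSum A₁ A₂ r (x - 1, y - 1) (x', y') := by
  have e (C : ℤ × ℤ) : pairSum A₁ A₂ r C (x', y') = ∑ P ∈ pathsFinset A₁ C,
      (∑ Q ∈ pathsFinset A₂ (x', y'), if r ≤ sideChanges A₁ A₂ P Q then wt Q else 0) * wt P := by
    refine Finset.sum_congr rfl fun P _ => ?_
    rw [Finset.sum_mul]
    refine Finset.sum_congr rfl fun Q _ => ?_
    split_ifs <;> ring
  -- Needed for `z = y` and for `z = y - 1`; the latter is why the odd case assumes a strict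
  -- inequality.
  have inv {z : ℤ} (hz : (Odd r ∧ y' ≤ z) ∨ (Even r ∧ x' ≤ x)) {P : Word} {s : Step}
      (hP : P ++ [s] ∈ pathsFinset A₁ (x, z)) :
      (∑ Q ∈ pathsFinset A₂ (x', y'), if r ≤ sideChanges A₁ A₂ (P ++ [s]) Q then wt Q else 0) =
      ∑ Q ∈ pathsFinset A₂ (x', y'), if r ≤ sideChanges A₁ A₂ P Q then wt Q else 0 :=
    Finset.sum_congr rfl fun Q hQ =>
      if_congr (le_sideChanges_concat_left hA hP hQ hz) rfl rfl
  simp only [e]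
  refine sum_paths_rec (fun _ => Finset.sum_eq_zero fun Q _ => ?_)
    (fun P hP => inv ?_ (concat_E_mem.2 hP)) (fun P hP => inv ?_ (concat_N_mem.2 hP))
    (fun P hP => inv ?_ (concat_E_mem.2 hP))
  · rw [sideChanges_nil_left, if_neg (by omega)]
  all_goals rcases h with ⟨h1, h2⟩ | h
            · exact Or.inl ⟨h1, by omega⟩
            · exact Or.inr h

theorem pairSum_rec_right (hA : A₁.1 + A₁.2 = A₂.1 + A₂.2) (hr : 1 ≤ r) {x y x' y' : ℤ}
    (h : (Odd r ∧ x ≤ x') ∨ (Even r ∧ y < y')) :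
    pairSum A₁ A₂ r (x, y) (x', y') = pairSum A₁ A₂ r (x, y) (x' - 1, y') +
      pairSum A₁ A₂ r (x, y) (x', y' - 1) +
      (tq (x' + y' - (A₂.1 + A₂.2) - 1) - 1) * pairSum A₁ A₂ r (x, y) (x' - 1, y' - 1) := by
  have e (C : ℤ × ℤ) : pairSum A₁ A₂ r (x, y) C = ∑ Q ∈ pathsFinset A₂ C,
      (∑ P ∈ pathsFinset A₁ (x, y), if r ≤ sideChanges A₁ A₂ P Q then wt P else 0) * wt Q := by
    rw [pairSum, Finset.sum_comm]
    refine Finset.sum_congr rfl fun Q _ => ?_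
    rw [Finset.sum_mul]
    refine Finset.sum_congr rfl fun P _ => ?_
    split_ifs <;> ring
  have inv {z : ℤ} (hz : (Odd r ∧ x ≤ x') ∨ (Even r ∧ y ≤ z)) {Q : Word} {s : Step}
      (hQ : Q ++ [s] ∈ pathsFinset A₂ (x', z)) :
      (∑ P ∈ pathsFinset A₁ (x, y), if r ≤ sideChanges A₁ A₂ P (Q ++ [s]) then wt P else 0) =
      ∑ P ∈ pathsFinset A₁ (x, y), if r ≤ sideChanges A₁ A₂ P Q then wt P else 0 :=
    Finset.sum_congr rfl fun P hP =>
      if_congr (le_sideChanges_concat_right hA hP hQ hz) rfl rfl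
  simp only [e]
  refine sum_paths_rec (fun _ => Finset.sum_eq_zero fun Q _ => ?_)
    (fun P hP => inv ?_ (concat_E_mem.2 hP)) (fun P hP => inv ?_ (concat_N_mem.2 hP))
    (fun P hP => inv ?_ (concat_E_mem.2 hP))
  · rw [sideChanges_nil_right, if_neg (by omega)]
  all_goals rcases h with h | ⟨h1, h2⟩
            · exact Or.inl h
            · exact Or.inr ⟨h1, by omega⟩

theorem sum_pairs_of_nil {x y x' y' : ℤ} {G : Word → Word → Polynomial (RatFunc ℚ)}
    (h₁ : ∀ Q, G [] Q = 0) (h₂ : ∀ P, G P [] = 0) :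
    ∑ P ∈ pathsFinset A₁ (x, y), ∑ Q ∈ pathsFinset A₂ (x', y'), G P Q =
      ∑ P ∈ pathsFinset A₁ (x - 1, y), ∑ Q ∈ pathsFinset A₂ (x' - 1, y'),
        G (P ++ [Step.E]) (Q ++ [Step.E]) +
      ∑ P ∈ pathsFinset A₁ (x - 1, y), ∑ Q ∈ pathsFinset A₂ (x', y' - 1),
        G (P ++ [Step.E]) (Q ++ [Step.N]) +
      ∑ P ∈ pathsFinset A₁ (x, y - 1), ∑ Q ∈ pathsFinset A₂ (x' - 1, y'),
        G (P ++ [Step.N]) (Q ++ [Step.E]) +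
      ∑ P ∈ pathsFinset A₁ (x, y - 1), ∑ Q ∈ pathsFinset A₂ (x', y' - 1),
        G (P ++ [Step.N]) (Q ++ [Step.N]) := by
  rw [sum_paths_of_nil fun _ => Finset.sum_eq_zero fun Q _ => h₁ Q]
  simp only [sum_paths_of_nil fun _ : (x', y') = A₂ => h₂ _, Finset.sum_add_distrib]
  ring

theorem stepSum_E_E (C₁ C₂ : ℤ × ℤ) :
    stepSum A₁ A₂ r C₁ C₂ Step.E Step.E = pairSum A₁ A₂ r C₁ C₂ := by
  simp only [stepSum, pairSum, wt_concat_E]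

/-- Used with `u` equal to `wt` and to the weight after one further N; `α` and `β` are the factors
contributed by that N. -/
theorem sum_concat_concat (hA : A₁.1 + A₁.2 = A₂.1 + A₂.2) {x y : ℤ} {C₁ C₂ : ℤ × ℤ} {s s' : Step}
    {α β : Polynomial (RatFunc ℚ)} (u : Word → Polynomial (RatFunc ℚ))
    (h₁ : ∀ P ∈ pathsFinset A₁ C₁,
      P ++ [s] ∈ pathsFinset A₁ (x, y) ∧ u (P ++ [s]) = α * wt (P ++ [s]))
    (h₂ : ∀ Q ∈ pathsFinset A₂ C₂,
      Q ++ [s'] ∈ pathsFinset A₂ (x, y) ∧ u (Q ++ [s']) = β * wt (Q ++ [s'])) :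
    ∑ P ∈ pathsFinset A₁ C₁, ∑ Q ∈ pathsFinset A₂ C₂,
      (if r ≤ sideChanges A₁ A₂ (P ++ [s]) (Q ++ [s']) then u (P ++ [s]) * u (Q ++ [s']) else 0) =
    α * β * stepSum A₁ A₂ r C₁ C₂ s s' := by
  rw [stepSum, Finset.mul_sum]
  refine Finset.sum_congr rfl fun P hP => ?_
  rw [Finset.mul_sum]
  refine Finset.sum_congr rfl fun Q hQ => ?_
  rw [sideChanges_concat_concat hA (h₁ P hP).1 (h₂ Q hQ).1, (h₁ P hP).2, (h₂ Q hQ).2]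
  split_ifs
  · ring
  · rw [mul_zero]

theorem pairSum_diag (hA : A₁.1 + A₁.2 = A₂.1 + A₂.2) (hr : 1 ≤ r) (x y : ℤ) :
    pairSum A₁ A₂ r (x, y) (x, y) = pairSum A₁ A₂ r (x - 1, y) (x - 1, y) +
      stepSum A₁ A₂ r (x - 1, y) (x, y - 1) Step.E Step.N +
      stepSum A₁ A₂ r (x, y - 1) (x - 1, y) Step.N Step.E +
      stepSum A₁ A₂ r (x, y - 1) (x, y - 1) Step.N Step.N := by
  have hE {A : ℤ × ℤ} : ∀ P ∈ pathsFinset A (x - 1, y), P ++ [Step.E] ∈ pathsFinset A (x, y) ∧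
      wt (P ++ [Step.E]) = 1 * wt (P ++ [Step.E]) :=
    fun P hP => ⟨concat_E_mem.2 hP, (one_mul _).symm⟩
  have hN {A : ℤ × ℤ} : ∀ P ∈ pathsFinset A (x, y - 1), P ++ [Step.N] ∈ pathsFinset A (x, y) ∧
      wt (P ++ [Step.N]) = 1 * wt (P ++ [Step.N]) :=
    fun P hP => ⟨concat_N_mem.2 hP, (one_mul _).symm⟩
  rw [pairSum, sum_pairs_of_nil, ← stepSum_E_E, sum_concat_concat hA wt hE hE,
    sum_concat_concat hA wt hE hN, sum_concat_concat hA wt hN hE, sum_concat_concat hA wt hN hN]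
  · ring
  · intro Q; rw [sideChanges_nil_left, if_neg (by omega)]
  · intro P; rw [sideChanges_nil_right, if_neg (by omega)]

theorem stepSum_N_N (hA : A₁.1 + A₁.2 = A₂.1 + A₂.2) (hr : 1 ≤ r) (x y : ℤ) :
    stepSum A₁ A₂ r (x, y) (x, y) Step.N Step.N =
      tq (x + y - (A₁.1 + A₁.2)) ^ 2 * pairSum A₁ A₂ r (x - 1, y) (x - 1, y) +
      tq (x + y - (A₁.1 + A₁.2)) * stepSum A₁ A₂ r (x - 1, y) (x, y - 1) Step.E Step.N +
      tq (x + y - (A₁.1 + A₁.2)) * stepSum A₁ A₂ r (x, y - 1) (x - 1, y) Step.N Step.E +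
      stepSum A₁ A₂ r (x, y - 1) (x, y - 1) Step.N Step.N := by
  have hE {A : ℤ × ℤ} (hA' : A₁.1 + A₁.2 = A.1 + A.2) : ∀ P ∈ pathsFinset A (x - 1, y),
      P ++ [Step.E] ∈ pathsFinset A (x, y) ∧
      wt (P ++ [Step.E] ++ [Step.N]) = tq (x + y - (A₁.1 + A₁.2)) * wt (P ++ [Step.E]) := by
    refine fun P hP => ⟨concat_E_mem.2 hP, ?_⟩
    rw [wt_concat_E_N, length_of_mem_pathsFinset hP, hA', wt_concat_E]
    congr 2
    ring
  have hN {A : ℤ × ℤ} : ∀ P ∈ pathsFinset A (x, y - 1), P ++ [Step.N] ∈ pathsFinset A (x, y) ∧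
      wt (P ++ [Step.N] ++ [Step.N]) = 1 * wt (P ++ [Step.N]) :=
    fun P hP => ⟨concat_N_mem.2 hP, by rw [wt_concat_N_N, one_mul]⟩
  rw [stepSum, sum_pairs_of_nil, ← stepSum_E_E,
    sum_concat_concat hA (fun P => wt (P ++ [Step.N])) (hE rfl) (hE hA),
    sum_concat_concat hA (fun P => wt (P ++ [Step.N])) (hE rfl) hN,
    sum_concat_concat hA (fun P => wt (P ++ [Step.N])) hN (hE hA),
    sum_concat_concat hA (fun P => wt (P ++ [Step.N])) hN hN]
  · ring
  · intro Q; rw [sideChanges_nil_left, if_neg (by omega)]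
  · intro P; rw [sideChanges_nil_right, if_neg (by omega)]

/-- The second path is one step longer than the first, so its last step is invisible to
`sideChanges`. -/
theorem pairSum_E_end (hA : A₁.1 + A₁.2 = A₂.1 + A₂.2) (x y : ℤ) :
    pairSum A₁ A₂ r (x - 1, y) (x, y) = pairSum A₁ A₂ r (x - 1, y) (x - 1, y) +
      stepSum A₁ A₂ r (x - 1, y) (x, y - 1) Step.E Step.N := by
  rw [pairSum, pairSum, stepSum, ← Finset.sum_add_distrib]
  refine Finset.sum_congr rfl fun P hP => ?_
  have hP' := length_of_mem_pathsFinset hP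
  rw [sum_paths_of_nil]
  · congr 1
    all_goals
      refine Finset.sum_congr rfl fun Q hQ => ?_
      have hQ' := length_of_mem_pathsFinset hQ
      rw [sideChanges_concat_right_of_le (by omega)]
      simp only [wt_concat_E]
  · rintro rfl
    simp only at hA hP'
    omega

theorem pairSum_end_E (hA : A₁.1 + A₁.2 = A₂.1 + A₂.2) (x y : ℤ) :
    pairSum A₁ A₂ r (x, y) (x - 1, y) = pairSum A₁ A₂ r (x - 1, y) (x - 1, y) +
      stepSum A₁ A₂ r (x, y - 1) (x - 1, y) Step.N Step.E := by
  rw [pairSum, pairSum, stepSum, Finset.sum_comm, Finset.sum_comm (s := pathsFinset A₁ (x - 1, y)),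
    Finset.sum_comm (s := pathsFinset A₁ (x, y - 1)), ← Finset.sum_add_distrib]
  refine Finset.sum_congr rfl fun Q hQ => ?_
  have hQ' := length_of_mem_pathsFinset hQ
  rw [sum_paths_of_nil]
  · congr 1
    all_goals
      refine Finset.sum_congr rfl fun P hP => ?_
      have hP' := length_of_mem_pathsFinset hP
      rw [sideChanges_concat_left_of_le (by omega)]
      simp only [wt_concat_E]
  · rintro rfl
    simp only at hA hQ'
    omega

/-- The order of the end points forces an odd number of side changes, and an odd number that is at
least the even number `r - 1` is at least `r`. This links `r` to `r - 1`. -/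
theorem stepSum_N_E_pred (hA : A₁.1 + A₁.2 = A₂.1 + A₂.2) (hx : A₁.1 ≤ A₂.1) (hr : Odd r)
    (x y : ℤ) : stepSum A₁ A₂ r (x, y - 1) (x - 1, y) Step.N Step.E =
      stepSum A₁ A₂ (r - 1) (x, y - 1) (x - 1, y) Step.N Step.E := by
  refine Finset.sum_congr rfl fun P hP => Finset.sum_congr rfl fun Q hQ => if_congr ?_ rfl rfl
  have := odd_sideChanges hA hx hP hQ (by omega) (by omega)
  grind

theorem stepSum_E_N_pred (hA : A₁.1 + A₁.2 = A₂.1 + A₂.2) (hr : Even r) (hr' : 1 ≤ r)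
    (x y : ℤ) : stepSum A₁ A₂ r (x - 1, y) (x, y - 1) Step.E Step.N =
      stepSum A₁ A₂ (r - 1) (x - 1, y) (x, y - 1) Step.E Step.N := by
  refine Finset.sum_congr rfl fun P hP => Finset.sum_congr rfl fun Q hQ => if_congr ?_ rfl rfl
  have := even_sideChanges hA hP hQ (by omega) (by omega)
  grind

theorem sol_pairSum_odd (hA : A₁.1 + A₁.2 = A₂.1 + A₂.2) (hx : A₁.1 ≤ A₂.1) (hr : Odd r) :
    Sol (A₁.1 + A₁.2)
      (fun x y => pairSum A₁ A₂ (r - 1) (x, y) (x - 1, y) -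
        pairSum A₁ A₂ (r - 1) (x - 1, y) (x - 1, y))
      (fun ux uy vx vy => pairSum A₁ A₂ r (ux, uy) (vx, vy)) where
  zero ux uy vx vy h := pairSum_eq_zero (by rwa [← hA])
  left ux uy vx vy _ h := pairSum_rec_left hA hr.pos (Or.inl ⟨hr, h⟩)
  right ux uy vx vy h _ := by
    rw [hA]
    exact pairSum_rec_right hA hr.pos (Or.inl ⟨hr, h.le⟩)
  diag x y := by
    have h := stepSum_N_N hA hr.pos x (y - 1)
    rw [show x + (y - 1) - (A₁.1 + A₁.2) = x + y - (A₁.1 + A₁.2) - 1 by ring] at h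
    simp only [pairSum_end_E hA, pairSum_E_end hA, ← stepSum_N_E_pred hA hx hr,
      pairSum_diag hA hr.pos x]
    linear_combination h

/-- For even `r` the region is reached with the two paths exchanged: the second one ends at the
upper left point. -/
theorem sol_pairSum_even (hA : A₁.1 + A₁.2 = A₂.1 + A₂.2) (hr : Even r) (hr' : 1 ≤ r) :
    Sol (A₁.1 + A₁.2)
      (fun x y => pairSum A₁ A₂ (r - 1) (x - 1, y) (x, y) -
        pairSum A₁ A₂ (r - 1) (x - 1, y) (x - 1, y))
      (fun ux uy vx vy => pairSum A₁ A₂ r (vx, vy) (ux, uy)) where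
  zero ux uy vx vy h := pairSum_eq_zero (by rw [← hA]; exact h.symm)
  left ux uy vx vy _ h := by
    rw [hA]
    exact pairSum_rec_right hA hr' (Or.inr ⟨hr, h⟩)
  right ux uy vx vy h _ := pairSum_rec_left hA hr' (Or.inr ⟨hr, h.le⟩)
  diag x y := by
    have h := stepSum_N_N hA hr' x (y - 1)
    rw [show x + (y - 1) - (A₁.1 + A₁.2) = x + y - (A₁.1 + A₁.2) - 1 by ring] at h
    simp only [pairSum_end_E hA, pairSum_E_end hA, ← stepSum_E_N_pred hA hr hr',
      pairSum_diag hA hr' x]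
    linear_combination h

end

/-! ### Identification of the generating functions with f_r. -/

theorem qsum_zero_zero_zero : qsum 0 0 0 = 1 := by
  ext n
  rw [coeff_qsum, Polynomial.coeff_one]
  rcases n with _ | n
  · simp [qbin]
  · rw [qbin_of_not (by omega)]
    simp

/-- Both sides obey the same recursion. For `qsum` with `k = 0` it needs only one nonzero
coordinate, so just the starting point is exceptional. -/
theorem sum_wt (A : ℤ × ℤ) (x y : ℤ) :
    ∑ P ∈ pathsFinset A (x, y), wt P = qsum 0 (x - A.1) (y - A.2) := by
  suffices h : ∀ n : ℕ, ∀ x y : ℤ, x + y - (A.1 + A.2) < n →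
      ∑ P ∈ pathsFinset A (x, y), wt P = qsum 0 (x - A.1) (y - A.2) from
    h ((x + y - (A.1 + A.2)).toNat + 1) _ _ (by omega)
  intro n
  induction n with
  | zero =>
    intro x y h
    rw [pathsFinset_eq_empty (by push_cast at h; simp only; omega), Finset.sum_empty]
    by_cases h' : x - A.1 < 0
    · exact (qsum_eq_zero_of_left (Or.inl h')).symm
    · exact (qsum_eq_zero_of_right (by omega)).symm
  | succ n ih =>
    intro x y h
    push_cast at h
    by_cases hxy : (x, y) = A
    · subst hxy
      rw [sum_paths, pathsFinset_eq_empty (B := (x - 1, y)) (by simp),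
        pathsFinset_eq_empty (B := (x, y - 1)) (by simp)]
      simp [qsum_zero_zero_zero, wt, des, maj, descents]
    · have h1 := sum_paths_rec (A := A) (x := x) (y := y) (κ := fun _ => 1)
        (fun h => absurd h hxy) (fun _ _ => rfl) (fun _ _ => rfl) (fun _ _ => rfl)
      simp only [one_mul] at h1
      rw [h1, ih _ _ (by omega), ih _ _ (by omega), ih _ _ (by omega), sub_right_comm x,
        sub_right_comm y, show x + y - (A.1 + A.2) - 1 = x - A.1 + (y - A.2) - 1 by ring]
      by_cases hx : x - A.1 = 0
      · refine (qsum_rec_of_nonpos le_rfl (fun hy => hxy ?_) _).symm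
        ext <;> simp only <;> omega
      · exact (qsum_rec_of_nonneg le_rfl hx _).symm

theorem pairSum_zero (A₁ A₂ C₁ C₂ : ℤ × ℤ) : pairSum A₁ A₂ 0 C₁ C₂ = f 0 A₁ A₂ C₁ C₂ := by
  simp [pairSum, f, ← Finset.sum_mul_sum, ← sum_wt]

/-- The generating function for at least `r` changes of sides, where the endpoints lie in the
order that has the parity of `r`, or coincide. -/
theorem pairSum_eq_f {A₁ A₂ : ℤ × ℤ} (hA : A₁.1 + A₁.2 = A₂.1 + A₂.2) (hx : A₁.1 ≤ A₂.1) (r : ℕ) :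
    ∀ U V : ℤ × ℤ, U.1 ≤ V.1 → V.2 ≤ U.2 →
      (Odd r → pairSum A₁ A₂ r U V = f r A₁ A₂ V U) ∧
      (Even r → pairSum A₁ A₂ r V U = f r A₁ A₂ V U) := by
  induction r with
  | zero => exact fun U V _ _ => ⟨fun h => by simp at h, fun _ => pairSum_zero _ _ _ _⟩
  | succ r ih =>
    rintro ⟨ux, uy⟩ ⟨vx, vy⟩ hux huy
    have hf := sol_f (x₁ := A₁.1) (y₁ := A₁.2) (x₂ := A₂.1) (y₂ := A₂.2) hx hA
      (k := ((r + 1 : ℕ) : ℤ)) (by omega)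
    rw [show ((r + 1 : ℕ) : ℤ) - 1 = r by push_cast; ring] at hf
    refine ⟨fun hr => ?_, fun hr => ?_⟩
    · have hr' : Even r := by grind
      have h := sol_pairSum_odd hA hx hr
      rw [Nat.add_sub_cancel] at h
      refine Sol.unique (F := fun ux uy vx vy => pairSum A₁ A₂ (r + 1) (ux, uy) (vx, vy)) ?_ hf
        hux huy
      convert h using 3 with x y
      -- The inhomogeneity `ρ` involves `r` only at horizontally adjacent or equal end points, in
      -- the order covered by the induction hypothesis.
      rw [(ih (x - 1, y) (x, y) (by simp) le_rfl).2 hr',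
        (ih (x - 1, y) (x - 1, y) le_rfl le_rfl).2 hr']
    · have hr' : Odd r := by grind
      have h := sol_pairSum_even hA hr (by omega)
      rw [Nat.add_sub_cancel] at h
      refine Sol.unique (F := fun ux uy vx vy => pairSum A₁ A₂ (r + 1) (vx, vy) (ux, uy)) ?_ hf
        hux huy
      convert h using 3 with x y
      rw [(ih (x - 1, y) (x, y) (by simp) le_rfl).1 hr',
        (ih (x - 1, y) (x - 1, y) le_rfl le_rfl).1 hr']

/-! ### From side changes back to crossings. -/

theorem H_eq_sum (r : ℕ) (A₁ C₁ A₂ C₂ : ℤ × ℤ) : H r A₁ C₁ A₂ C₂ =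
    ∑ P ∈ pathsFinset A₁ C₁, ∑ Q ∈ pathsFinset A₂ C₂,
      if r ≤ cro A₁ A₂ P Q then wt P * wt Q else 0 := by
  rw [← Finset.sum_product', ← Finset.sum_filter, H]
  refine Finset.sum_congr ?_ fun p _ => ?_
  · ext p
    simp [pairs, mem_pathsFinset_iff_paths, and_assoc]
  · simp only [wt, pow_add, map_mul]
    ring

theorem cro_eq_sideChanges {A₁ A₂ : ℤ × ℤ} (hA : A₁.1 + A₁.2 = A₂.1 + A₂.2) (hx : A₁.1 < A₂.1)
    (P Q : Word) : cro A₁ A₂ P Q = sideChanges A₁ A₂ P Q := by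
  rw [sideChanges_eq hA hx.le, if_neg, add_zero]
  rintro ⟨i, -, h, hz⟩
  rcases Nat.eq_zero_or_pos i with rfl | hi
  · rw [gap_zero] at h; omega
  · have := hz 0 hi
    rw [gap_zero] at this; omega

theorem H_eq_pairSum {A₁ A₂ : ℤ × ℤ} (hA : A₁.1 + A₁.2 = A₂.1 + A₂.2) (hx : A₁.1 < A₂.1)
    (r : ℕ) (C₁ C₂ : ℤ × ℤ) : H r A₁ C₁ A₂ C₂ = pairSum A₁ A₂ r C₁ C₂ := by
  simp only [H_eq_sum, pairSum, cro_eq_sideChanges hA hx]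

theorem pairSum_succ_of_even {A₁ A₂ : ℤ × ℤ} (hA : A₁.1 + A₁.2 = A₂.1 + A₂.2) (hx : A₁.1 ≤ A₂.1)
    {r : ℕ} (hr : Even r) {B₁ B₂ : ℤ × ℤ} (hB : Prec B₁ B₂) :
    pairSum A₁ A₂ (r + 1) B₂ B₁ = pairSum A₁ A₂ r B₂ B₁ := by
  refine Finset.sum_congr rfl fun P hP => Finset.sum_congr rfl fun Q hQ => if_congr ?_ rfl rfl
  have := odd_sideChanges hA hx hP hQ hB.1 hB.2
  grind

theorem pairSum_succ_of_odd {A₁ A₂ : ℤ × ℤ} (hA : A₁.1 + A₁.2 = A₂.1 + A₂.2)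
    {r : ℕ} (hr : Odd r) {B₁ B₂ : ℤ × ℤ} (hB : Prec B₁ B₂) :
    pairSum A₁ A₂ (r + 1) B₁ B₂ = pairSum A₁ A₂ r B₁ B₂ := by
  refine Finset.sum_congr rfl fun P hP => Finset.sum_congr rfl fun Q hQ => if_congr ?_ rfl rfl
  have := even_sideChanges hA hP hQ hB.1 hB.2
  grind

theorem gap_swap (A : ℤ × ℤ) (P Q : Word) : gap A A Q P = fun i => -gap A A P Q i := by
  funext i
  simp [gap]

theorem cro_swap (A : ℤ × ℤ) (P Q : Word) : cro A A Q P = cro A A P Q := by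
  rw [cro_eq_zeroChanges rfl, cro_eq_zeroChanges rfl, gap_swap, zeroChanges_neg, min_comm]

theorem H_swap (r : ℕ) (A C₁ C₂ : ℤ × ℤ) : H r A C₁ A C₂ = H r A C₂ A C₁ := by
  rw [H_eq_sum, H_eq_sum, Finset.sum_comm]
  refine Finset.sum_congr rfl fun P _ => Finset.sum_congr rfl fun Q _ => ?_
  rw [cro_swap, mul_comm]

theorem cro_le_sideChanges (A : ℤ × ℤ) (P Q : Word) :
    cro A A P Q ≤ sideChanges A A P Q ∧ sideChanges A A P Q ≤ cro A A P Q + 1 := by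
  rw [sideChanges_eq rfl le_rfl]
  split_ifs <;> omega

/-- A crossing ensures that some gap is nonzero, and the first such gap is negative for exactly one
order of the pair. -/
theorem sideChanges_add_swap {A : ℤ × ℤ} {P Q : Word} (h : 1 ≤ cro A A P Q) :
    sideChanges A A P Q + sideChanges A A Q P = 2 * cro A A P Q + 1 := by
  rw [sideChanges_eq rfl le_rfl, sideChanges_eq rfl le_rfl, cro_swap, gap_swap A P Q, min_comm]
  generalize hn : min Q.length P.length = n
  generalize hδ : gap A A P Q = δ
  have hne : ∃ i ≤ n, δ i ≠ 0 := by
    by_contra! hall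
    rw [cro_eq_zeroChanges rfl, min_comm, hn, hδ] at h
    obtain ⟨j, hj, -, ⟨-, h'⟩ | ⟨-, h'⟩⟩ := exists_changesAt h <;>
      exact absurd (hall (j + 1) hj) (by omega)
  classical
  have hi := Nat.find_spec hne
  have hmin : ∀ j < Nat.find hne, δ j = 0 := fun j hj => by
    by_contra hj'
    exact Nat.find_min hne hj ⟨by omega, hj'⟩
  generalize Nat.find hne = i at hi hmin
  have huniq : ∀ k, δ k ≠ 0 → (∀ j < k, δ j = 0) → k = i := fun k hk hk' => by
    rcases lt_trichotomy k i with h' | h' | h'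
    · exact absurd (hmin k h') hk
    · exact h'
    · exact absurd (hk' i h') hi.2
  have hF : FirstNeg δ n ↔ δ i < 0 := by
    constructor
    · rintro ⟨k, hk, hneg, hz⟩
      rwa [huniq k hneg.ne hz] at hneg
    · exact fun h => ⟨i, hi.1, h, hmin⟩
  have hF' : FirstNeg (fun i => -δ i) n ↔ 0 < δ i := by
    constructor
    · rintro ⟨k, hk, hneg, hz⟩
      have hpos : 0 < δ k := neg_lt_zero.1 hneg
      rwa [huniq k hpos.ne' fun j hj => neg_eq_zero.1 (hz j hj)] at hpos
    · exact fun h => ⟨i, hi.1, by simpa using h, fun j hj => by simp [hmin j hj]⟩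
  rw [hF, hF']
  split_ifs <;> omega

/-- `sideChanges` exceeds `cro` by at most 1, and the end points give it the parity opposite to `r`.
So if it is at least `r` it is at least `r + 1`, and then `cro` is at least `r`. -/
theorem H_eq_f_of_prec {A B₁ B₂ : ℤ × ℤ} (hB : Prec B₁ B₂) (r : ℕ) :
    H r A B₁ A B₂ = f r A A B₂ B₁ := by
  rcases Nat.even_or_odd r with hr | hr
  · rw [H_swap, ← (pairSum_eq_f rfl le_rfl r B₁ B₂ hB.1.le hB.2.le).2 hr, H_eq_sum]
    refine Finset.sum_congr rfl fun P hP => Finset.sum_congr rfl fun Q hQ => if_congr ?_ rfl rfl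
    have := odd_sideChanges rfl le_rfl hP hQ hB.1 hB.2
    have := cro_le_sideChanges A P Q
    grind
  · rw [← (pairSum_eq_f rfl le_rfl r B₁ B₂ hB.1.le hB.2.le).1 hr, H_eq_sum]
    refine Finset.sum_congr rfl fun P hP => Finset.sum_congr rfl fun Q hQ => if_congr ?_ rfl rfl
    have := even_sideChanges rfl hP hQ hB.1 hB.2
    have := cro_le_sideChanges A P Q
    grind

theorem pairSum_diag_eq_f {A₁ A₂ : ℤ × ℤ} (hA : A₁.1 + A₁.2 = A₂.1 + A₂.2) (hx : A₁.1 ≤ A₂.1)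
    (r : ℕ) (B : ℤ × ℤ) : pairSum A₁ A₂ r B B = f r A₁ A₂ B B := by
  rcases Nat.even_or_odd r with hr | hr
  · exact (pairSum_eq_f hA hx r B B le_rfl le_rfl).2 hr
  · exact (pairSum_eq_f hA hx r B B le_rfl le_rfl).1 hr

/-- For a pair with a crossing, the two orders give the side change counts `cro` and `cro + 1`. Sum
the condition "at least r + 1" over both orders. For r = 0 the pairs of equal paths would spoil
this. -/
theorem H_add_H_succ {A B : ℤ × ℤ} {r : ℕ} (hr : 1 ≤ r) :
    H r A B A B + H (r + 1) A B A B = 2 * f ((r : ℤ) + 1) A A B B := by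
  have h := pairSum_diag_eq_f (A₁ := A) (A₂ := A) rfl le_rfl (r + 1) B
  push_cast at h
  rw [← h, two_mul]
  nth_rewrite 2 [pairSum]
  rw [Finset.sum_comm, pairSum, H_eq_sum, H_eq_sum, ← Finset.sum_add_distrib,
    ← Finset.sum_add_distrib]
  refine Finset.sum_congr rfl fun P _ => ?_
  rw [← Finset.sum_add_distrib, ← Finset.sum_add_distrib]
  refine Finset.sum_congr rfl fun Q _ => ?_
  have h1 := cro_le_sideChanges A P Q
  have h2 := cro_le_sideChanges A Q P
  rw [cro_swap] at h2
  have h3 := @sideChanges_add_swap A P Q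
  rw [mul_comm (wt Q)]
  split_ifs <;> first | omega | ring

theorem H_eq_alternating_sum (A B : ℤ × ℤ) {r : ℕ} (hr : 1 ≤ r) : H r A B A B =
    2 * ∑ᶠ j : ℕ, (-1) ^ j * f ((r : ℤ) + j + 1) A A B B := by
  have hsum (N : ℕ) : 2 * ∑ j ∈ Finset.range N, (-1) ^ j * f ((r : ℤ) + j + 1) A A B B =
      H r A B A B - (-1) ^ N * H (r + N) A B A B := by
    induction N with
    | zero => simp
    | succ N ih =>
      have h := H_add_H_succ (A := A) (B := B) (r := r + N) (by omega)
      push_cast at h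
      rw [Finset.sum_range_succ, mul_add, ih, pow_succ, ← add_assoc]
      linear_combination (-(-1) ^ N) * h
  have hzero : ∃ N : ℕ, (∀ j : ℕ, N ≤ j → f ((r : ℤ) + j + 1) A A B B = 0) ∧
      H (r + N) A B A B = 0 := by
    -- The first summand bounds the path length and hence the number of crossings; the second one
    -- makes the f terms vanish.
    refine ⟨(B.1 + B.2 - (A.1 + A.2)).toNat + (B.2 - A.2).toNat + 1,
      fun j hj => f_eq_zero _ _ _ _ _ (by omega), ?_⟩
    rw [H_eq_sum]
    refine Finset.sum_eq_zero fun P hP => Finset.sum_eq_zero fun Q hQ => if_neg ?_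
    have h1 := length_of_mem_pathsFinset hP
    have h2 : cro A A P Q ≤ P.length := by
      rw [cro_eq_zeroChanges rfl]
      exact (zeroChanges_le _ _).trans (min_le_left _ _)
    omega
  obtain ⟨N, hN, hH⟩ := hzero
  rw [finsum_eq_sum_of_support_subset (s := Finset.range N), hsum, hH]
  · ring
  · intro j hj
    by_contra hj'
    simp only [Finset.coe_range, Set.mem_Iio, not_lt] at hj'
    exact hj (by simp only [hN j hj', mul_zero])

end LatticePairs

end

theorem theorem2p2 :
    -- four distinct endpoints
    (∀ A₁ A₂ B₁ B₂ : ℤ × ℤ, LatticePairs.Prec A₁ A₂ → LatticePairs.Prec B₁ B₂ →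
      A₁.1 + A₁.2 = A₂.1 + A₂.2 → ∀ m : ℕ,
        (LatticePairs.H (2 * m + 1) A₁ B₂ A₂ B₁ = LatticePairs.H (2 * m) A₁ B₂ A₂ B₁ ∧
          LatticePairs.H (2 * m) A₁ B₂ A₂ B₁ = LatticePairs.f (2 * m) A₁ A₂ B₂ B₁) ∧
        (LatticePairs.H (2 * m + 2) A₁ B₁ A₂ B₂ = LatticePairs.H (2 * m + 1) A₁ B₁ A₂ B₂ ∧
          LatticePairs.H (2 * m + 1) A₁ B₁ A₂ B₂ = LatticePairs.f (2 * m + 1) A₁ A₂ B₂ B₁)) ∧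
    -- common starting point
    (∀ A B₁ B₂ : ℤ × ℤ, LatticePairs.Prec B₁ B₂ → ∀ r : ℕ,
      LatticePairs.H r A B₁ A B₂ = LatticePairs.f r A A B₂ B₁) ∧
    -- common end point
    (∀ A₁ A₂ B : ℤ × ℤ, LatticePairs.Prec A₁ A₂ → A₁.1 + A₁.2 = A₂.1 + A₂.2 → ∀ r : ℕ,
      LatticePairs.H r A₁ B A₂ B = LatticePairs.f r A₁ A₂ B B) ∧
    -- both endpoints in common; the sum over `j ≥ 1` is indexed by `j - 1`
    (∀ A B : ℤ × ℤ,
      LatticePairs.H 0 A B A B = LatticePairs.f 0 A A B B ∧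
      ∀ r : ℕ, 1 ≤ r →
        LatticePairs.H r A B A B =
          2 * ∑ᶠ j : ℕ, (-1) ^ j * LatticePairs.f ((r : ℤ) + j + 1) A A B B) := by
  refine ⟨fun A₁ A₂ B₁ B₂ hA hB hlevel m => ?_, fun A B₁ B₂ hB r => LatticePairs.H_eq_f_of_prec hB r,
    fun A₁ A₂ B hA hlevel r => ?_, fun A B => ⟨?_, fun r hr =>
      LatticePairs.H_eq_alternating_sum A B hr⟩⟩
  · have he : Even (2 * m) := even_two_mul m
    have ho : Odd (2 * m + 1) := odd_two_mul_add_one m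
    simp only [LatticePairs.H_eq_pairSum hlevel hA.1]
    refine ⟨⟨LatticePairs.pairSum_succ_of_even hlevel hA.1.le he hB, ?_⟩,
      LatticePairs.pairSum_succ_of_odd hlevel ho hB, ?_⟩
    · have h := (LatticePairs.pairSum_eq_f hlevel hA.1.le (2 * m) B₁ B₂ hB.1.le hB.2.le).2 he
      exact_mod_cast h
    · have h := (LatticePairs.pairSum_eq_f hlevel hA.1.le (2 * m + 1) B₁ B₂ hB.1.le hB.2.le).1 ho
      exact_mod_cast h
  · rw [LatticePairs.H_eq_pairSum hlevel hA.1, LatticePairs.pairSum_diag_eq_f hlevel hA.1.le]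
  · rw [← LatticePairs.pairSum_zero, LatticePairs.H_eq_sum, LatticePairs.pairSum]
    simp only [Nat.zero_le, if_true]
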